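/- **Theorem (optimal complexity of the sub-sampled trust-region method for finite sums).** *Problem.* Let $n,d\ge 1$ and $F(x)=\frac1n\sum_{i=1}^n f_i(x)$ on $\mathbb R^d$ (P1), with each $f_i:\mathbb R^d\to\mathbb R$ twice differentiable, $\sup_x\|\nabla^2 f_i(x)\|\le K_i$ (spectral norm), and $F$ bounded below. In the special case (P2) the $i$-th summand has the form $x\mapsto f_i(a_i^Tx)$ with $f_i:\mathbb R\to\mathbb R$, $a_i\in\mathbb R^d$. Put $K_{\max}=\max_iK_i$ and $\widehat K=\frac1n\sum_iK_i$. *Sub-sampled Hessian.* For a finite sample $\mathcal S$ of indices (with possible repetitions) and probabilities $p_i$ put $H(x)=\frac1{n|\mathcal S|}\sum_{j\in\mathcal S}\frac1{p_j}\nabla^2 f_j(x)$ (in the case of (P2), $\nabla^2 f_j(x)$ stands for the Hessian of $x\mapsto f_j(a_j^Tx)$). The sample is drawn - for (P1): uniformly, with or without replacement, with $p_i=1/n$; size $|\mathcal S|\ge \frac{16K_{\max}^2}{\epsilon^2}\log\frac{2d}{\delta_0}$; or - for (P2): independently with $p_i=\frac{|f_i''(a_i^Tx)|\|a_i\|^2}{\sum_j|f_j''(a_j^Tx)|\|a_j\|^2}$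 (uniformly, if the denominator is $0$); size $|\mathcal S|\ge \frac{4\widehat K^2}{\epsilon^2}\log\frac{2d}{\delta_0}$. (In all cases $|\mathcal S|\ge1$, and $|\mathcal S|\le n$ when sampling without replacement.) *Algorithm.* Let $x_0\in\mathbb R^d$, $\Delta_0>0$, $\eta,\alpha\in(0,1)$, $\gamma>1$, $\nu\in(0,1]$, $\epsilon_g,\epsilon_H\in(0,1)$ and $\epsilon_0=\alpha(1-\eta)\nu\epsilon_H$. At iteration $t=0,1,\dots$: choose, before the sample of iteration $t$ is drawn, a tolerance $0<\epsilon_t\le\max\{\epsilon_0,\Delta_t\}$ and a sample size as above with $\epsilon=\epsilon_t$; draw the sample, given the past, by the chosen strategy at $x_t$, and form $H_t=H(x_t)$. If $\|\nabla F(x_t)\|\le\epsilon_g$ and $\lambda_{\min}(H_t)\ge-\epsilon_H$, return $x_t$. Otherwise compute $s_t$ with $\|s_t\|\le\Delta_t$, set $m_t(s)=\langle\nabla F(x_t),s\rangle+\frac12\langle s,H_ts\rangle$ and $\rho_t=\frac{F(x_t)-F(x_t+s_t)}{-m_t(s_t)}$. If $\rho_t\ge\eta$, put $x_{t+1}=x_t+s_t$,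 $\Delta_{t+1}=\gamma\Delta_t$; otherwise $x_{t+1}=x_t$, $\Delta_{t+1}=\Delta_t/\gamma$. *Assumptions on the path*, for the steps $s_t$ that are computed. 1. There is $L>0$ with $\|\nabla^2F(y)-\nabla^2F(x_t)\|\le L\|y-x_t\|$ for all $y\in[x_t,x_t+s_t]$. 2. $-m_t(s_t)\ge-m_t(s_t^C)\ge\frac12\|\nabla F(x_t)\|\min\{\frac{\|\nabla F(x_t)\|}{1+\|H_t\|},\Delta_t\}$ for some $s_t^C$ along $-\nabla F(x_t)$; and, if $\lambda_{\min}(H_t)<0$, $-m_t(s_t)\ge-m_t(s_t^E)\ge\frac12\nu|\lambda_{\min}(H_t)|\Delta_t^2$ for some $s_t^E$ with $\langle s_t^E,H_ts_t^E\rangle\le\nu\lambda_{\min}(H_t)\|s_t^E\|^2<0$. *Claim.* There are constants $C,c>0$, depending only on $\eta,\gamma,\nu,\alpha,\Delta_0,L$ and on upper bounds for $F(x_0)-\inf F$ and for $K_{\max}$ (uniform sampling), respectively $\widehat K$ (non-uniform sampling), such that for all $\epsilon_g,\epsilon_H,\delta\in(0,1)$, if the per-iteration failure probability in the sample sizes is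 $$\delta_0=\min\bigl\{c,\ \delta\min\{\epsilon_g^2\epsilon_H,\epsilon_H^3\}\bigr\},$$ then with probability at least $1-\delta$ the algorithm terminates within $C\max\{\epsilon_g^{-2}\epsilon_H^{-1},\epsilon_H^{-3}\}$ iterations, and the returned point $x_T$ satisfies $\|\nabla F(x_T)\|\le\epsilon_g$ and $\lambda_{\min}(\nabla^2F(x_T))\ge-(\epsilon_T+\epsilon_H)$. In particular $\delta_0=\delta\min\{\epsilon_g^2\epsilon_H,\epsilon_H^3\}$ whenever this number is at most $c$. -/

import Mathlib

open MeasureTheory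

universe u

noncomputable section

namespace SubsampledTR

/-- Euclidean space of dimension `d`; operators on it carry the spectral norm. -/
abbrev E (d : ℕ) : Type := EuclideanSpace ℝ (Fin d)

/-- The Hessian of `f` at `x`, as the derivative of the gradient. -/
def hess {d : ℕ} (f : E d → ℝ) (x : E d) : E d →L[ℝ] E d := fderiv ℝ (gradient f) x

def TwiceDifferentiable {d : ℕ} (f : E d → ℝ) : Prop :=
  Differentiable ℝ f ∧ Differentiable ℝ (gradient f)

/-- The smallest eigenvalue (used for symmetric operators on a space of positive dimension). -/
def lamMin {d : ℕ} (A : E d →L[ℝ] E d) : ℝ :=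
  sInf {μ : ℝ | Module.End.HasEigenvalue (A : E d →ₗ[ℝ] E d) μ}

/-- The objective `F = (1/n) ∑ i, f i`. -/
def finiteSum {n d : ℕ} (f : Fin n → E d → ℝ) (x : E d) : ℝ := (1 / (n : ℝ)) * ∑ i, f i x

/-- The summands `x ↦ φ i (a iᵀ x)` of the special finite-sum problem. -/
def ridge {n d : ℕ} (φ : Fin n → ℝ → ℝ) (a : Fin n → E d) : Fin n → E d → ℝ :=
  fun i x => φ i (inner ℝ (a i) x)

/-- The three sub-sampling strategies. Uniform sampling applies to every finite sum, non-uniform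
sampling to sums of ridge functions. -/
inductive Sampling {n d : ℕ} : (Fin n → E d → ℝ) → Type
  | uniformWithReplacement (f : Fin n → E d → ℝ) : Sampling f
  | uniformWithoutReplacement (f : Fin n → E d → ℝ) : Sampling f
  | nonuniform (φ : Fin n → ℝ → ℝ) (a : Fin n → E d) : Sampling (ridge φ a)

/-- `|φ i''(a iᵀ x)| ‖a i‖²`. -/
def weight {n d : ℕ} (φ : Fin n → ℝ → ℝ) (a : Fin n → E d) (x : E d) (i : Fin n) : ℝ :=
  |deriv (deriv (φ i)) (inner ℝ (a i) x)| * ‖a i‖ ^ 2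

/-- The sampling probabilities proportional to `weight`; if all weights vanish (then all the
Hessians of the summands vanish at `x`), the uniform distribution. -/
def nonuniformProb {n d : ℕ} (φ : Fin n → ℝ → ℝ) (a : Fin n → E d) (x : E d) (i : Fin n) : ℝ :=
  if ∑ j, weight φ a x j = 0 then 1 / (n : ℝ) else weight φ a x i / ∑ j, weight φ a x j

/-- The probability that `s` independent draws from `p` give the list `l`. -/
def lawWithReplacement {n : ℕ} (p : Fin n → ℝ) (s : ℕ) (l : List (Fin n)) : ℝ :=
  if l.length = s then (l.map p).prod else 0

/-- The probability that `s` successive uniform draws without replacement from `n` indices give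
the list `l` (it makes sense for `s ≤ n`; for `s > n` no list has positive mass). -/
def lawWithoutReplacement {n : ℕ} (s : ℕ) (l : List (Fin n)) : ℝ :=
  if l.length = s ∧ l.Nodup then 1 / (n.descFactorial s : ℝ) else 0

namespace Sampling

/-- The probabilities `p` that appear in the sub-sampled Hessian at `x`. -/
def prob {n d : ℕ} {f : Fin n → E d → ℝ} : Sampling f → E d → Fin n → ℝ
  | uniformWithReplacement _, _, _ => 1 / (n : ℝ)
  | uniformWithoutReplacement _, _, _ => 1 / (n : ℝ)
  | nonuniform φ a, x, i => nonuniformProb φ a x i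

/-- The law of a sample of size `s` drawn at the point `x`. -/
def law {n d : ℕ} {f : Fin n → E d → ℝ} : Sampling f → E d → ℕ → List (Fin n) → ℝ
  | uniformWithReplacement _, _, s, l => lawWithReplacement (fun _ => 1 / (n : ℝ)) s l
  | uniformWithoutReplacement _, _, s, l => lawWithoutReplacement s l
  | nonuniform φ a, x, s, l => lawWithReplacement (nonuniformProb φ a x) s l

/-- `max K i` for uniform sampling, the mean of the `K i` for non-uniform sampling. -/
def bound {n d : ℕ} {f : Fin n → E d → ℝ} : Sampling f → (Fin n → ℝ) → ℝ
  | uniformWithReplacement _, K => ⨆ i, K i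
  | uniformWithoutReplacement _, K => ⨆ i, K i
  | nonuniform _ _, K => (1 / (n : ℝ)) * ∑ i, K i

/-- The sample size required for accuracy `ε` with failure probability `δ₀`. -/
def requiredSize {n d : ℕ} {f : Fin n → E d → ℝ} : Sampling f → (Fin n → ℝ) → ℝ → ℝ → ℝ
  | uniformWithReplacement _, K, ε, δ₀ =>
      16 * (⨆ i, K i) ^ 2 / ε ^ 2 * Real.log (2 * d / δ₀)
  | uniformWithoutReplacement _, K, ε, δ₀ =>
      16 * (⨆ i, K i) ^ 2 / ε ^ 2 * Real.log (2 * d / δ₀)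
  | nonuniform _ _, K, ε, δ₀ =>
      4 * ((1 / (n : ℝ)) * ∑ i, K i) ^ 2 / ε ^ 2 * Real.log (2 * d / δ₀)

end Sampling

/-- The sub-sampled Hessian `(1 / (n |S|)) ∑_{j ∈ S} (1 / p j) ∇² f j (x)`. -/
def subHess {n d : ℕ} (f : Fin n → E d → ℝ) (p : Fin n → ℝ) (S : List (Fin n)) (x : E d) :
    E d →L[ℝ] E d :=
  (1 / ((n : ℝ) * (S.length : ℝ))) • (S.map fun j => (1 / p j) • hess (f j) x).sum

/-- The quadratic model `⟨∇F(x), s⟩ + ⟨s, H s⟩ / 2`. -/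
def model {d : ℕ} (F : E d → ℝ) (x : E d) (H : E d →L[ℝ] E d) (s : E d) : ℝ :=
  inner ℝ (gradient F x) s + (1 / 2) * inner ℝ s (H s)

/-- The stopping test of the algorithm. -/
def Stops {d : ℕ} (F : E d → ℝ) (εg εH : ℝ) (x : E d) (H : E d →L[ℝ] E d) : Prop :=
  ‖gradient F x‖ ≤ εg ∧ -εH ≤ lamMin H

/-- Iteration `t` is reached: the stopping test failed at all earlier iterations. -/
def Reached {d : ℕ} (F : E d → ℝ) (εg εH : ℝ) (x : ℕ → E d) (H : ℕ → E d →L[ℝ] E d)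
    (t : ℕ) : Prop :=
  ∀ k < t, ¬ Stops F εg εH (x k) (H k)

/-- Iteration `t` is reached and does not return, so that a step is computed. -/
def Active {d : ℕ} (F : E d → ℝ) (εg εH : ℝ) (x : ℕ → E d) (H : ℕ → E d →L[ℝ] E d)
    (t : ℕ) : Prop :=
  Reached F εg εH x H t ∧ ¬ Stops F εg εH (x t) (H t)

/-- The ratio of actual to predicted decrease. -/
def rho {d : ℕ} (F : E d → ℝ) (x : E d) (H : E d →L[ℝ] E d) (s : E d) : ℝ :=
  (F x - F (x + s)) / (-model F x H s)

/-- One path of the trust-region algorithm with approximate Hessians `H t`, steps `s t` and radii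
`Δ t`. Nothing is required after the algorithm has returned. -/
structure IsTrustRegionPath {d : ℕ} (F : E d → ℝ) (η γ Δ₀ εg εH : ℝ) (x₀ : E d)
    (x s : ℕ → E d) (Δ : ℕ → ℝ) (H : ℕ → E d →L[ℝ] E d) : Prop where
  init_point : x 0 = x₀
  init_radius : Δ 0 = Δ₀
  feasible : ∀ t, Active F εg εH x H t → ‖s t‖ ≤ Δ t
  success : ∀ t, Active F εg εH x H t → η ≤ rho F (x t) (H t) (s t) →
    x (t + 1) = x t + s t ∧ Δ (t + 1) = γ * Δ t
  failure : ∀ t, Active F εg εH x H t → rho F (x t) (H t) (s t) < η →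
    x (t + 1) = x t ∧ Δ (t + 1) = Δ t / γ

/-- The Cauchy and eigenpoint conditions on an approximate solution `s` of the sub-problem. -/
def SufficientDescent {d : ℕ} (F : E d → ℝ) (ν : ℝ) (x : E d) (H : E d →L[ℝ] E d) (Δ : ℝ)
    (s : E d) : Prop :=
  (∃ sC : E d, (∃ c : ℝ, 0 ≤ c ∧ sC = -(c • gradient F x)) ∧
    -model F x H sC ≤ -model F x H s ∧
    (1 / 2) * ‖gradient F x‖ * min (‖gradient F x‖ / (1 + ‖H‖)) Δ ≤ -model F x H sC) ∧
  (lamMin H < 0 → ∃ sE : E d,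
    inner ℝ sE (H sE) ≤ ν * lamMin H * ‖sE‖ ^ 2 ∧ ν * lamMin H * ‖sE‖ ^ 2 < 0 ∧
    -model F x H sE ≤ -model F x H s ∧
    (1 / 2) * ν * |lamMin H| * Δ ^ 2 ≤ -model F x H sE)

/-- Lipschitz continuity of the Hessian of `F`, seen from `x`, on the segment `[x, x + s]`. -/
def HessLipschitzOnStep {d : ℕ} (F : E d → ℝ) (L : ℝ) (x s : E d) : Prop :=
  ∀ y ∈ segment ℝ x (x + s), ‖hess F y - hess F x‖ ≤ L * ‖y - x‖

/-- The approximate Hessians along a path `x` with samples `S`. -/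
def pathHess {n d : ℕ} {f : Fin n → E d → ℝ} (σ : Sampling f) (x : ℕ → E d)
    (S : ℕ → List (Fin n)) (t : ℕ) : E d →L[ℝ] E d :=
  subHess f (σ.prob (x t)) (S t) (x t)

/-- A random run of the sub-sampled trust-region algorithm on a probability space. The
sigma-algebra `ℱ t` is the information available before the sample `S t` of iteration `t` is drawn:
the iterate `x t`, the radius `Δ t`, the tolerance `ε t` and the sample size `m t` are known then,
and `S t` is drawn, given `ℱ t`, by the strategy `σ`. -/
structure IsSubsampledRun {n d : ℕ} {f : Fin n → E d → ℝ} (σ : Sampling f) (K : Fin n → ℝ)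
    (L η γ ν Δ₀ ε₀ εg εH δ₀ : ℝ) (x₀ : E d)
    {Ω : Type u} [mΩ : MeasurableSpace Ω] (μ : Measure Ω) (ℱ : Filtration ℕ mΩ)
    (x s : ℕ → Ω → E d) (Δ ε : ℕ → Ω → ℝ) (m : ℕ → Ω → ℕ) (S : ℕ → Ω → List (Fin n)) :
    Prop where
  measurable_x : ∀ t, Measurable[ℱ t] (x t)
  measurable_radius : ∀ t, Measurable[ℱ t] (Δ t)
  measurable_tolerance : ∀ t, Measurable[ℱ t] (ε t)
  measurable_size : ∀ t, Measurable[ℱ t] (m t)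
  measurable_sample : ∀ t l, MeasurableSet[ℱ (t + 1)] {ω | S t ω = l}
  path : ∀ᵐ ω ∂μ, IsTrustRegionPath (finiteSum f) η γ Δ₀ εg εH x₀ (x · ω) (s · ω) (Δ · ω)
    (pathHess σ (x · ω) (S · ω))
  tolerance : ∀ᵐ ω ∂μ, ∀ t, Reached (finiteSum f) εg εH (x · ω) (pathHess σ (x · ω) (S · ω)) t →
    0 < ε t ω ∧ ε t ω ≤ max ε₀ (Δ t ω)
  size : ∀ᵐ ω ∂μ, ∀ t, Reached (finiteSum f) εg εH (x · ω) (pathHess σ (x · ω) (S · ω)) t →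
    0 < m t ω ∧ σ.requiredSize K (ε t ω) δ₀ ≤ m t ω
  sample : ∀ t l, ∀ᵐ ω ∂μ,
    Reached (finiteSum f) εg εH (x · ω) (pathHess σ (x · ω) (S · ω)) t →
    (μ[Set.indicator {ω' | S t ω' = l} (fun _ => (1 : ℝ)) | ℱ t]) ω = σ.law (x t ω) (m t ω) l
  descent : ∀ᵐ ω ∂μ, ∀ t, Active (finiteSum f) εg εH (x · ω) (pathHess σ (x · ω) (S · ω)) t →
    SufficientDescent (finiteSum f) ν (x t ω) (pathHess σ (x · ω) (S · ω) t) (Δ t ω) (s t ω)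
  lipschitz : ∀ᵐ ω ∂μ, ∀ t, Active (finiteSum f) εg εH (x · ω) (pathHess σ (x · ω) (S · ω)) t →
    HessLipschitzOnStep (finiteSum f) L (x t ω) (s t ω)

end SubsampledTR

end

namespace SubsampledTR

/-! The argument has a probabilistic half and a deterministic half, joined by a union bound in which
a surplus exponent removes the constant from the failure probability.

Probability: a matrix Hoeffding bound shows that a sub-sampled Hessian misses its tolerance with
probability at most `δ₀ ^ (4 / 3)`, not merely `δ₀` (`Sampling.tsum_law_bad_le`). The trace
exponential is controlled one draw at a time by comparing the eigenbases of `M` and `M + Y`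
(`trExp_add_le`, `sum_mul_trExp_le`). In each step the mean is absorbed into `M`, so the uncentred
bound `K` governs the exponent. The tail is `2d exp(-s ε² / (3K²))`, and a sample size with constant
`4` yields the exponent `4/3`. Without replacement, the conditional mean of the next draw pulls the
centred sum towards `0`, which does no harm by convexity.

Determinism: if all Hessians are accurate, a small radius forces success
(`success_of_small_radius`), so radii stay above a multiple of `q₁ = min εg εH`. A successful step
then decreases `F` by a multiple of `εH q₁²`, which equals `q = min (εg² εH) (εH³)`. A potential
combining `F` and `log Δ` bounds the number of steps by `C₀ / q` (`steps_le`).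

Union bound: with `C = C₀ + 1`, at most `C / q` iterations are watched. Since `δ₀ ≤ δ q` and `δ₀ ^
(1 / 3) ≤ 1 / C`, the total failure probability is at most `(C / q) δ₀ ^ (4 / 3) ≤ δ`
(`sum_failure_le`). At the stopping point an accurate Hessian transfers the eigenvalue test to the
true one (`lamMin_sub_le`). -/

/-! ### Trace exponentials and one step of the matrix Hoeffding bound. -/

/-- The difference of the two sides vanishes to first order at `0` and is convex: its second
derivative is `(2/3)(1 - eˣ(1 - x - x²/4))`, nonnegative by `1 - x ≤ e⁻ˣ`. Part of the square
carries the factor `eˣ` because no bound `1 + x + c x²` of the exponential holds for all `x`; in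
`trExp_add_le` this part is charged to the second eigenbasis. -/
lemma exp_mul_one_sub_sq_le (x : ℝ) :
    Real.exp x * (1 - x ^ 2 / 6) ≤ 1 + x + x ^ 2 / 3 := by
  let G : ℝ → ℝ := fun x => 1 + x + x ^ 2 / 3 - Real.exp x * (1 - x ^ 2 / 6)
  let G' : ℝ → ℝ := fun x => 1 + 2 * x / 3 - Real.exp x * (1 - x / 3 - x ^ 2 / 6)
  let G'' : ℝ → ℝ := fun x => 2 / 3 - Real.exp x * (2 / 3 - 2 * x / 3 - x ^ 2 / 6)
  have h1 : ∀ x, HasDerivAt G (G' x) x := fun x => by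
    have := (((hasDerivAt_const x (1 : ℝ)).add (hasDerivAt_id x)).add
      (((hasDerivAt_id x).pow 2).div_const 3)).sub
      ((Real.hasDerivAt_exp x).mul ((hasDerivAt_const x (1 : ℝ)).sub
        (((hasDerivAt_id x).pow 2).div_const 6)))
    refine this.congr_deriv ?_
    simp [G']; ring
  have h2 : ∀ x, HasDerivAt G' (G'' x) x := fun x => by
    have := ((hasDerivAt_const x (1 : ℝ)).add (((hasDerivAt_id x).const_mul 2).div_const 3)).sub
      ((Real.hasDerivAt_exp x).mul (((hasDerivAt_const x (1 : ℝ)).sub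
        ((hasDerivAt_id x).div_const 3)).sub (((hasDerivAt_id x).pow 2).div_const 6)))
    refine this.congr_deriv ?_
    simp [G'']; ring
  have h3 : ∀ x, 0 ≤ G'' x := fun x => by
    have e1 : 1 - x - x ^ 2 / 4 ≤ Real.exp (-x) := by
      nlinarith [Real.add_one_le_exp (-x), sq_nonneg x]
    have e2 : Real.exp x * (1 - x - x ^ 2 / 4) ≤ 1 := by
      calc _ ≤ Real.exp x * Real.exp (-x) := by gcongr
        _ = 1 := by rw [← Real.exp_add]; simp
    simp only [G'']; linarith
  have hmono : Monotone G' := monotone_of_hasDerivAt_nonneg h2 h3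
  have hG0 : G 0 = 0 := by simp [G]
  have hG'0 : G' 0 = 0 := by simp [G']
  have hc : Continuous G := continuous_iff_continuousAt.2 fun x => (h1 x).continuousAt
  have : 0 ≤ G x := by
    rcases le_total 0 x with hx | hx
    · have : MonotoneOn G (Set.Ici 0) := by
        refine monotoneOn_of_hasDerivWithinAt_nonneg (convex_Ici 0) hc.continuousOn
          (fun y _ => (h1 y).hasDerivWithinAt) fun y hy => ?_
        rw [interior_Ici] at hy
        exact hG'0 ▸ hmono (le_of_lt hy)
      simpa [hG0] using this (Set.mem_Ici.2 le_rfl) (Set.mem_Ici.2 hx) hx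
    · have : AntitoneOn G (Set.Iic 0) := by
        refine antitoneOn_of_hasDerivWithinAt_nonpos (convex_Iic 0) hc.continuousOn
          (fun y _ => (h1 y).hasDerivWithinAt) fun y hy => ?_
        rw [interior_Iic] at hy
        exact hG'0 ▸ hmono (le_of_lt hy)
      simpa [hG0] using this (Set.mem_Iic.2 hx) (Set.mem_Iic.2 le_rfl) hx
  simp only [G] at this
  linarith

/-- Symmetry of a bounded operator on Euclidean space. -/
abbrev IsSymm {d : ℕ} (T : E d →L[ℝ] E d) : Prop := (T : E d →ₗ[ℝ] E d).IsSymmetric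

open Classical in
/-- The trace of the exponential of a symmetric operator, as a sum over its eigenvalues. -/
noncomputable def trExp {d : ℕ} (T : E d →L[ℝ] E d) : ℝ :=
  if h : IsSymm T then ∑ i, Real.exp (h.eigenvalues finrank_euclideanSpace_fin i) else 0

variable {d : ℕ}

lemma IsSymm.add {S T : E d →L[ℝ] E d} (hS : IsSymm S) (hT : IsSymm T) : IsSymm (S + T) :=
  fun x y => by simpa [inner_add_left, inner_add_right] using congrArg₂ (· + ·) (hS x y) (hT x y)

lemma IsSymm.smul {T : E d →L[ℝ] E d} (hT : IsSymm T) (c : ℝ) : IsSymm (c • T) :=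
  fun x y => by simpa [inner_smul_left, inner_smul_right] using congrArg (c * ·) (hT x y)

lemma IsSymm.neg {T : E d →L[ℝ] E d} (hT : IsSymm T) : IsSymm (-T) :=
  fun x y => by simpa [inner_neg_left, inner_neg_right] using hT x y

lemma IsSymm.sub {S T : E d →L[ℝ] E d} (hS : IsSymm S) (hT : IsSymm T) : IsSymm (S - T) := by
  simpa [sub_eq_add_neg] using hS.add hT.neg

lemma IsSymm.zero : IsSymm (0 : E d →L[ℝ] E d) := fun x y => by simp

lemma IsSymm.sum {ι : Type*} (s : Finset ι) {T : ι → E d →L[ℝ] E d} (h : ∀ i ∈ s, IsSymm (T i)) :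
    IsSymm (∑ i ∈ s, T i) := by
  classical
  induction s using Finset.induction_on with
  | empty => simpa using IsSymm.zero
  | insert a s ha ih =>
    rw [Finset.sum_insert ha]
    exact (h a (by simp)).add (ih fun i hi => h i (by simp [hi]))

lemma exists_eigenbasis {T : E d →L[ℝ] E d} (hT : IsSymm T) :
    ∃ (u : OrthonormalBasis (Fin d) ℝ (E d)) (l : Fin d → ℝ),
      (∀ i, T (u i) = l i • u i) ∧ trExp T = ∑ i, Real.exp (l i) := by
  refine ⟨hT.eigenvectorBasis finrank_euclideanSpace_fin,
    hT.eigenvalues finrank_euclideanSpace_fin, fun i => ?_, ?_⟩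
  · exact hT.apply_eigenvectorBasis finrank_euclideanSpace_fin i
  · simp only [trExp]
    rw [dif_pos hT]

lemma sum_inner_sq_right (v : OrthonormalBasis (Fin d) ℝ (E d)) (x : E d) :
    ∑ b, inner ℝ x (v b) ^ 2 = ‖x‖ ^ 2 := by
  simpa using v.sum_sq_norm_inner_left x

lemma sum_inner_sq_left (v : OrthonormalBasis (Fin d) ℝ (E d)) (x : E d) :
    ∑ b, inner ℝ (v b) x ^ 2 = ‖x‖ ^ 2 := by
  simpa using v.sum_sq_norm_inner_right x

lemma sum_eigen_mul_inner_sq {N : E d →L[ℝ] E d} (hN : IsSymm N)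
    (v : OrthonormalBasis (Fin d) ℝ (E d)) {m : Fin d → ℝ} (hv : ∀ i, N (v i) = m i • v i)
    (x : E d) : ∑ b, m b * inner ℝ x (v b) ^ 2 = inner ℝ x (N x) := by
  rw [← v.sum_inner_mul_inner x (N x)]
  refine Finset.sum_congr rfl fun b _ => ?_
  have h : inner ℝ (N (v b)) x = inner ℝ (v b) (N x) := hN (v b) x
  rw [← h, hv, real_inner_smul_left, real_inner_comm x (v b)]
  ring

/-- Peierls' inequality. -/
lemma sum_exp_inner_le_trExp {N : E d →L[ℝ] E d} (hN : IsSymm N)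
    (u : OrthonormalBasis (Fin d) ℝ (E d)) :
    ∑ a, Real.exp (inner ℝ (u a) (N (u a))) ≤ trExp N := by
  obtain ⟨v, m, hv, hΦ⟩ := exists_eigenbasis hN
  have key : ∀ a, Real.exp (inner ℝ (u a) (N (u a))) ≤
      ∑ b, inner ℝ (u a) (v b) ^ 2 * Real.exp (m b) := fun a => by
    set r := inner ℝ (u a) (N (u a)) with hr
    have h1 : ∑ b, inner ℝ (u a) (v b) ^ 2 = 1 := by
      rw [sum_inner_sq_right]; simp
    have h2 := sum_eigen_mul_inner_sq hN v hv (u a)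
    -- Jensen's inequality for the weights `⟨u a, v b⟩²`, through the tangent line of `exp` at the
    -- mean `r`.
    calc Real.exp r = ∑ b, inner ℝ (u a) (v b) ^ 2 * (Real.exp r * (1 + (m b - r))) := by
          have : ∀ b, inner ℝ (u a) (v b) ^ 2 * (Real.exp r * (1 + (m b - r))) =
              Real.exp r * (1 - r) * inner ℝ (u a) (v b) ^ 2 +
                Real.exp r * (m b * inner ℝ (u a) (v b) ^ 2) := fun b => by ring
          simp_rw [this, Finset.sum_add_distrib, ← Finset.mul_sum]
          rw [h1, h2, ← hr]; ring
      _ ≤ _ := by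
          refine Finset.sum_le_sum fun b _ => mul_le_mul_of_nonneg_left ?_ (sq_nonneg _)
          calc _ ≤ Real.exp r * Real.exp (m b - r) := by
                gcongr; linarith [Real.add_one_le_exp (m b - r)]
            _ = _ := by rw [← Real.exp_add]; congr 1; ring
  refine (Finset.sum_le_sum fun a _ => key a).trans ?_
  rw [Finset.sum_comm, hΦ]
  refine Finset.sum_le_sum fun b _ => ?_
  rw [← Finset.sum_mul, sum_inner_sq_left]
  simp

lemma trExp_nonneg (T : E d →L[ℝ] E d) : 0 ≤ trExp T := by
  unfold trExp
  split_ifs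
  · positivity
  · exact le_rfl

lemma exp_inner_le_trExp {N : E d →L[ℝ] E d} (hN : IsSymm N) {v : E d} (hv : ‖v‖ = 1) :
    Real.exp (inner ℝ v (N v)) ≤ trExp N := by
  obtain ⟨u, m, hu, hΦ⟩ := exists_eigenbasis hN
  have h1 := sum_eigen_mul_inner_sq hN u hu v
  have h2 : ∑ b, inner ℝ v (u b) ^ 2 = 1 := by rw [sum_inner_sq_right, hv]; simp
  have h0 : (Finset.univ : Finset (Fin d)).Nonempty := by
    by_contra h
    rw [Finset.not_nonempty_iff_eq_empty] at h
    simp [h] at h2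
  obtain ⟨b, -, hb⟩ := Finset.exists_max_image Finset.univ m h0
  have h3 : inner ℝ v (N v) ≤ m b := by
    rw [← h1]
    calc _ ≤ ∑ c, m b * inner ℝ v (u c) ^ 2 :=
          Finset.sum_le_sum fun c hc => mul_le_mul_of_nonneg_right (hb c hc) (sq_nonneg _)
      _ = m b := by rw [← Finset.mul_sum, h2, mul_one]
  calc _ ≤ Real.exp (m b) := Real.exp_le_exp.2 h3
    _ ≤ _ := by
      rw [hΦ]
      exact Finset.single_le_sum (f := fun i => Real.exp (m i)) (fun i _ => (Real.exp_pos _).le)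
        (Finset.mem_univ b)

/-- Convexity of `exp` between `0` and the diagonal entries of `M` in an eigenbasis of `t • M`,
followed by Peierls' inequality. It handles the shrinking factor in sampling without replacement. -/
lemma trExp_smul_le {M : E d →L[ℝ] E d} (hM : IsSymm M) {t : ℝ} (h0 : 0 ≤ t) (h1 : t ≤ 1) :
    trExp (t • M) ≤ t * trExp M + (1 - t) * d := by
  obtain ⟨u, l, hu, hΦ⟩ := exists_eigenbasis (hM.smul t)
  have hl : ∀ a, l a = t * inner ℝ (u a) (M (u a)) := fun a => by
    have := congrArg (inner ℝ (u a)) (hu a)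
    simpa [inner_smul_right] using this.symm
  rw [hΦ]
  calc ∑ a, Real.exp (l a) ≤ ∑ a, (t * Real.exp (inner ℝ (u a) (M (u a))) + (1 - t)) := by
        refine Finset.sum_le_sum fun a _ => ?_
        have := convexOn_exp.2 (Set.mem_univ (inner ℝ (u a) (M (u a)))) (Set.mem_univ (0 : ℝ))
          h0 (sub_nonneg.2 h1) (by ring)
        simpa [hl] using this
    _ = t * ∑ a, Real.exp (inner ℝ (u a) (M (u a))) + (1 - t) * d := by
        rw [Finset.sum_add_distrib, ← Finset.mul_sum]; simp; ring
    _ ≤ _ := by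
        have := mul_le_mul_of_nonneg_left (sum_exp_inner_le_trExp hM u) h0
        linarith

lemma trExp_zero : trExp (0 : E d →L[ℝ] E d) = d := by
  obtain ⟨u, l, hu, hΦ⟩ := exists_eigenbasis (IsSymm.zero (d := d))
  have hl : ∀ a, l a = 0 := fun a => by
    have := congrArg (inner ℝ (u a)) (hu a)
    simpa [inner_smul_right] using this.symm
  simp [hΦ, hl]

/-- With eigenbases `u` of `M` and `v` of `M + Y`, the weights `⟨u a, v b⟩²` are doubly stochastic
and `(m b - l a)⟨u a, v b⟩ = ⟨Y (u a), v b⟩`. Apply the scalar inequality at `m b - l a`, multiply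
by `exp (l a)` and the weight, and sum: the linear term becomes the trace of `exp M` times `Y`, and
both quadratic terms are bounded by `‖Y w‖² ≤ k²` on unit vectors. The bound is affine in `Y` apart
from `k`, so it can be averaged. -/
lemma trExp_add_le {M Y : E d →L[ℝ] E d} (hM : IsSymm M) (hY : IsSymm Y) {k : ℝ}
    (hk : ‖Y‖ ≤ k) (u : OrthonormalBasis (Fin d) ℝ (E d)) {l : Fin d → ℝ}
    (hu : ∀ i, M (u i) = l i • u i) (hΦ : trExp M = ∑ i, Real.exp (l i)) :
    (1 - k ^ 2 / 6) * trExp (M + Y) ≤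
      (1 + k ^ 2 / 3) * trExp M + ∑ a, Real.exp (l a) * inner ℝ (u a) (Y (u a)) := by
  obtain ⟨v, m, hv, hΨ⟩ := exists_eigenbasis (hM.add hY)
  have hc : ∀ a b, inner ℝ (Y (u a)) (v b) = (m b - l a) * inner ℝ (u a) (v b) := fun a b => by
    have e1 : inner ℝ ((M + Y) (u a)) (v b) = m b * inner ℝ (u a) (v b) := by
      rw [show inner ℝ ((M + Y) (u a)) (v b) = inner ℝ (u a) ((M + Y) (v b)) from
        (hM.add hY) (u a) (v b), hv, real_inner_smul_right]
    rw [_root_.add_apply, inner_add_left, hu, real_inner_smul_left] at e1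
    linarith
  have hc' : ∀ a b, inner ℝ (u a) (Y (v b)) = (m b - l a) * inner ℝ (u a) (v b) := fun a b => by
    rw [← hc]; exact (hY (u a) (v b)).symm
  have hYn : ∀ w : E d, ‖w‖ = 1 → ‖Y w‖ ^ 2 ≤ k ^ 2 := fun w hw => by
    have : ‖Y w‖ ≤ k := (Y.le_opNorm w).trans (by rw [hw, mul_one]; exact hk)
    gcongr
  have s1 : ∀ a, ∑ b, inner ℝ (u a) (v b) ^ 2 = 1 := fun a => by rw [sum_inner_sq_right]; simp
  have s2 : ∀ b, ∑ a, inner ℝ (u a) (v b) ^ 2 = 1 := fun b => by rw [sum_inner_sq_left]; simp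
  have s3 : ∀ a, ∑ b, (m b - l a) ^ 2 * inner ℝ (u a) (v b) ^ 2 ≤ k ^ 2 := fun a => by
    calc _ = ∑ b, inner ℝ (Y (u a)) (v b) ^ 2 := by
          refine Finset.sum_congr rfl fun b _ => ?_
          rw [hc]; ring
      _ = ‖Y (u a)‖ ^ 2 := sum_inner_sq_right _ _
      _ ≤ _ := hYn _ (by simp)
  have s4 : ∀ b, ∑ a, (m b - l a) ^ 2 * inner ℝ (u a) (v b) ^ 2 ≤ k ^ 2 := fun b => by
    calc _ = ∑ a, inner ℝ (u a) (Y (v b)) ^ 2 := by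
          refine Finset.sum_congr rfl fun a _ => ?_
          rw [hc']; ring
      _ = ‖Y (v b)‖ ^ 2 := sum_inner_sq_left _ _
      _ ≤ _ := hYn _ (by simp)
  have s5 : ∀ a, ∑ b, (m b - l a) * inner ℝ (u a) (v b) ^ 2 = inner ℝ (u a) (Y (u a)) :=
      fun a => by
    rw [real_inner_comm, ← v.sum_inner_mul_inner]
    refine Finset.sum_congr rfl fun b _ => ?_
    rw [hc, real_inner_comm (u a) (v b)]; ring
  have pw : ∀ a b, inner ℝ (u a) (v b) ^ 2 * Real.exp (m b) -
      Real.exp (m b) / 6 * ((m b - l a) ^ 2 * inner ℝ (u a) (v b) ^ 2) ≤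
      Real.exp (l a) * inner ℝ (u a) (v b) ^ 2 +
      Real.exp (l a) * ((m b - l a) * inner ℝ (u a) (v b) ^ 2) +
      Real.exp (l a) / 3 * ((m b - l a) ^ 2 * inner ℝ (u a) (v b) ^ 2) := fun a b => by
    have h := mul_le_mul_of_nonneg_left (exp_mul_one_sub_sq_le (m b - l a)) (Real.exp_pos (l a)).le
    rw [← mul_assoc, ← Real.exp_add, show l a + (m b - l a) = m b by ring] at h
    have h' := mul_le_mul_of_nonneg_left h (sq_nonneg (inner ℝ (u a) (v b)))
    linarith
  have L := Finset.sum_le_sum fun a (_ : a ∈ Finset.univ) =>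
    Finset.sum_le_sum fun b (_ : b ∈ Finset.univ) => pw a b
  simp_rw [Finset.sum_add_distrib, Finset.sum_sub_distrib, ← Finset.mul_sum, s5, s1, mul_one] at L
  -- The terms weighted by `exp (m b)` are summed over `a` first, so that the column sums `s2` and
  -- `s4` apply.
  rw [Finset.sum_comm, Finset.sum_comm (f := fun a b => Real.exp (m b) / 6 * _)] at L
  simp_rw [← Finset.mul_sum, ← Finset.sum_mul, s2, one_mul] at L
  have L1 : ∑ b, Real.exp (m b) / 6 * ∑ a, (m b - l a) ^ 2 * inner ℝ (u a) (v b) ^ 2 ≤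
      ∑ b, Real.exp (m b) / 6 * k ^ 2 :=
    Finset.sum_le_sum fun b _ => mul_le_mul_of_nonneg_left (s4 b) (by positivity)
  have L2 : ∑ a, Real.exp (l a) / 3 * ∑ b, (m b - l a) ^ 2 * inner ℝ (u a) (v b) ^ 2 ≤
      ∑ a, Real.exp (l a) / 3 * k ^ 2 :=
    Finset.sum_le_sum fun a _ => mul_le_mul_of_nonneg_left (s3 a) (by positivity)
  rw [← Finset.sum_mul, ← Finset.sum_div] at L1 L2
  rw [hΨ, hΦ]
  linarith

/-- One step of the matrix Hoeffding bound. -/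
lemma sum_mul_trExp_le {ι : Type*} [Fintype ι] {q : ι → ℝ} (hq : ∀ j, 0 ≤ q j)
    (hq1 : ∑ j, q j = 1) {Y : ι → E d →L[ℝ] E d} (hY : ∀ j, IsSymm (Y j)) {k : ℝ}
    (hk : ∀ j, ‖Y j‖ ≤ k) (hk2 : k ^ 2 ≤ 3) {H : E d →L[ℝ] E d} (hH : IsSymm H) :
    ∑ j, q j * trExp (H + (Y j - ∑ i, q i • Y i)) ≤ Real.exp (3 / 4 * k ^ 2) * trExp H := by
  set A := ∑ i, q i • Y i with hA
  have hAs : IsSymm A := IsSymm.sum _ fun i _ => (hY i).smul _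
  -- Since `H + (Y j - A) = M + Y j`, the perturbation is the uncentred `Y j`, of norm at most `k`
  -- rather than `2k`.
  set M := H - A with hM
  have hMs : IsSymm M := hH.sub hAs
  obtain ⟨u, l, hu, hΦ⟩ := exists_eigenbasis hMs
  have h1 : ∑ j, q j * ((1 - k ^ 2 / 6) * trExp (M + Y j)) ≤
      ∑ j, q j * ((1 + k ^ 2 / 3) * trExp M + ∑ a, Real.exp (l a) * inner ℝ (u a) (Y j (u a))) :=
    Finset.sum_le_sum fun j _ =>
      mul_le_mul_of_nonneg_left (trExp_add_le hMs (hY j) (hk j) u hu hΦ) (hq j)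
  have h2 : ∑ j, q j * ∑ a, Real.exp (l a) * inner ℝ (u a) (Y j (u a)) =
      ∑ a, Real.exp (l a) * inner ℝ (u a) (A (u a)) := by
    simp_rw [Finset.mul_sum]
    rw [Finset.sum_comm]
    refine Finset.sum_congr rfl fun a _ => ?_
    simp only [hA, _root_.sum_apply, inner_sum, Finset.mul_sum,
      _root_.smul_apply, inner_smul_right]
    exact Finset.sum_congr rfl fun j _ => by ring
  set g := ∑ a, Real.exp (l a) * inner ℝ (u a) (A (u a)) with hg
  have h3 : (1 - k ^ 2 / 6) * ∑ j, q j * trExp (M + Y j) ≤ (1 + k ^ 2 / 3) * trExp M + g := by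
    simp_rw [mul_add] at h1
    rw [Finset.sum_add_distrib, h2, ← Finset.sum_mul, hq1, one_mul] at h1
    convert h1 using 1
    rw [Finset.mul_sum]
    exact Finset.sum_congr rfl fun j _ => by ring
  -- Peierls–Bogoliubov: if `c` is the mean of `⟨u a, A (u a)⟩` under the weights `exp (l a)`, then
  -- `exp c * trExp M ≤ trExp (M + A)`. The degenerate case `trExp M = 0` is dimension zero.
  have h4 : (1 + k ^ 2 / 3) * trExp M + g ≤ Real.exp (k ^ 2 / 3) * trExp H := by
    rcases (trExp_nonneg M).eq_or_lt with h0 | h0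
    · have hl : ∀ a, Real.exp (l a) = 0 := fun a => by
        rw [← h0, eq_comm, Finset.sum_eq_zero_iff_of_nonneg fun _ _ => (Real.exp_pos _).le] at hΦ
        exact hΦ a (Finset.mem_univ a)
      have : g = 0 := Finset.sum_eq_zero fun a _ => by rw [hl, zero_mul]
      rw [← h0, this]
      simpa using mul_nonneg (Real.exp_pos (k ^ 2 / 3)).le (trExp_nonneg H)
    · set c := g / trExp M with hc
      have hgc : g = c * trExp M := by rw [hc]; field_simp
      have h5 : Real.exp c * trExp M ≤ trExp H := by
        refine le_trans ?_ (sum_exp_inner_le_trExp hH u)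
        calc Real.exp c * trExp M
            = ∑ a, Real.exp c * (Real.exp (l a) * (1 + (inner ℝ (u a) (A (u a)) - c))) := by
              have : ∀ a, Real.exp c * (Real.exp (l a) * (1 + (inner ℝ (u a) (A (u a)) - c))) =
                  Real.exp c * (1 - c) * Real.exp (l a) +
                  Real.exp c * (Real.exp (l a) * inner ℝ (u a) (A (u a))) := fun a => by ring
              simp_rw [this, Finset.sum_add_distrib, ← Finset.mul_sum]
              rw [← hg, ← hΦ, hgc]; ring
          _ ≤ _ := by
              refine Finset.sum_le_sum fun a _ => ?_
              have e1 : inner ℝ (u a) (H (u a)) = l a + inner ℝ (u a) (A (u a)) := by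
                rw [show H = M + A by simp [hM], _root_.add_apply, inner_add_right, hu,
                  real_inner_smul_right]
                simp
              rw [e1, show l a + inner ℝ (u a) (A (u a)) =
                c + (l a + (inner ℝ (u a) (A (u a)) - c)) by ring, Real.exp_add, Real.exp_add]
              gcongr
              linarith [Real.add_one_le_exp (inner ℝ (u a) (A (u a)) - c)]
      calc (1 + k ^ 2 / 3) * trExp M + g = (c + k ^ 2 / 3 + 1) * trExp M := by rw [hgc]; ring
        _ ≤ Real.exp (c + k ^ 2 / 3) * trExp M :=
            mul_le_mul_of_nonneg_right (Real.add_one_le_exp _) h0.le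
        _ = Real.exp (k ^ 2 / 3) * (Real.exp c * trExp M) := by rw [Real.exp_add]; ring
        _ ≤ _ := by gcongr
  have hpos : 0 < 1 - k ^ 2 / 6 := by linarith
  -- Here `3/4 = 1/3 + 5/12`, and `(1 - k²/6)(1 + 5k²/12) ≥ 1` as long as `k² ≤ 18/5`.
  have h6 : Real.exp (k ^ 2 / 3) ≤ (1 - k ^ 2 / 6) * Real.exp (3 / 4 * k ^ 2) := by
    have e0 : Real.exp (3 / 4 * k ^ 2) = Real.exp (k ^ 2 / 3) * Real.exp (5 / 12 * k ^ 2) := by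
      rw [← Real.exp_add]; congr 1; ring
    have e1 : 1 ≤ (1 - k ^ 2 / 6) * Real.exp (5 / 12 * k ^ 2) := by
      calc (1 : ℝ) ≤ (1 - k ^ 2 / 6) * (5 / 12 * k ^ 2 + 1) := by nlinarith [sq_nonneg k]
        _ ≤ _ := mul_le_mul_of_nonneg_left (Real.add_one_le_exp _) hpos.le
    rw [e0]
    nlinarith [Real.exp_pos (k ^ 2 / 3)]
  have h7 : ∀ j, H + (Y j - A) = M + Y j := fun j => by rw [hM]; abel
  simp_rw [h7]
  refine le_of_mul_le_mul_left ?_ hpos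
  calc _ ≤ Real.exp (k ^ 2 / 3) * trExp H := h3.trans h4
    _ ≤ (1 - k ^ 2 / 6) * Real.exp (3 / 4 * k ^ 2) * trExp H :=
        mul_le_mul_of_nonneg_right h6 (trExp_nonneg H)
    _ = _ := by ring

/-! ### Laws of samples as recursions over lists. -/

-- Allows induction on the sample size, with the head of the list as the latest draw. Values in
-- `ℝ≥0∞` remove every summability question.
open scoped ENNReal in
lemma tsum_list {ι : Type*} [Fintype ι] (h : List ι → ℝ≥0∞) :
    ∑' l, h l = h [] + ∑' l, ∑ j, h (j :: l) := by
  classical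
  rw [ENNReal.tsum_eq_add_tsum_ite []]
  congr 1
  have hinj : Function.Injective fun p : List ι × ι => p.2 :: p.1 := fun p q hpq => by
    simp only [List.cons.injEq] at hpq
    exact Prod.ext hpq.2 hpq.1
  rw [← hinj.tsum_eq, ENNReal.tsum_prod']
  · simp [tsum_fintype]
  · intro l hl
    cases l with
    | nil => simp at hl
    | cons j l => exact ⟨(l, j), rfl⟩

lemma sum_map_sub_const {ι V : Type*} [AddCommGroup V] [Module ℝ V] (l : List ι) (g : ι → V)
    (a : V) : (l.map fun j => g j - a).sum = (l.map g).sum - (l.length : ℝ) • a := by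
  induction l with
  | nil => simp
  | cons j l ih =>
    simp only [List.map_cons, List.sum_cons, List.length_cons, ih, Nat.cast_add, Nat.cast_one,
      add_smul, one_smul]
    abel

lemma IsSymm.list_sum {ι : Type*} (l : List ι) {T : ι → E d →L[ℝ] E d} (h : ∀ i, IsSymm (T i)) :
    IsSymm (l.map T).sum := by
  induction l with
  | nil => simpa using IsSymm.zero
  | cons j l ih => rw [List.map_cons, List.sum_cons]; exact (h j).add ih

lemma lawWithReplacement_nonneg {n : ℕ} {p : Fin n → ℝ} (hp : ∀ j, 0 ≤ p j) (s : ℕ)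
    (l : List (Fin n)) : 0 ≤ lawWithReplacement p s l := by
  unfold lawWithReplacement
  split_ifs
  · exact List.prod_nonneg (by simpa using fun a _ => hp a)
  · exact le_rfl

lemma lawWithReplacement_cons {n : ℕ} (p : Fin n → ℝ) (s : ℕ) (j : Fin n) (l : List (Fin n)) :
    lawWithReplacement p (s + 1) (j :: l) = lawWithReplacement p s l * p j := by
  simp [lawWithReplacement, mul_comm]

lemma lawWithoutReplacement_nonneg {n : ℕ} (s : ℕ) (l : List (Fin n)) :
    0 ≤ lawWithoutReplacement s l := by
  unfold lawWithoutReplacement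
  split_ifs <;> positivity

/-- The law of the next draw without replacement, after the draws `l`. -/
noncomputable def remainingProb {n : ℕ} (l : List (Fin n)) (j : Fin n) : ℝ :=
  if j ∈ l then 0 else 1 / ((n : ℝ) - l.length)

lemma lawWithoutReplacement_cons {n : ℕ} (s : ℕ) (j : Fin n) (l : List (Fin n)) :
    lawWithoutReplacement (s + 1) (j :: l) = lawWithoutReplacement s l * remainingProb l j := by
  unfold lawWithoutReplacement remainingProb
  by_cases hl : l.length = s ∧ l.Nodup
  · have hs : s ≤ n := by
      rw [← hl.1]; simpa using hl.2.length_le_card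
    by_cases hj : j ∈ l
    · simp [hj]
    · simp [hj, hl.1, hl.2, Nat.descFactorial_succ, Nat.cast_sub hs, mul_comm]
  · rw [if_neg hl, zero_mul, if_neg]
    simp only [List.length_cons, List.nodup_cons, add_left_inj]
    tauto

lemma sum_remainingProb_smul {n : ℕ} {l : List (Fin n)} (hl : l.Nodup)
    {V : Type*} [AddCommGroup V] [Module ℝ V] (g : Fin n → V) :
    ∑ j, remainingProb l j • g j =
      (1 / ((n : ℝ) - l.length)) • (∑ j, g j - (l.map g).sum) := by
  have h1 : (l.map g).sum = ∑ j, if j ∈ l then g j else 0 := by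
    rw [← List.sum_toFinset g hl, ← Finset.sum_filter]
    congr 1
    ext; simp
  rw [h1, ← Finset.sum_sub_distrib, Finset.smul_sum]
  refine Finset.sum_congr rfl fun j _ => ?_
  unfold remainingProb
  split_ifs <;> simp

lemma sum_remainingProb {n : ℕ} {l : List (Fin n)} (hl : l.Nodup) (h : l.length < n) :
    ∑ j, remainingProb l j = 1 := by
  have := sum_remainingProb_smul hl (fun _ => (1 : ℝ))
  simp only [smul_eq_mul, mul_one] at this
  rw [this]
  have h' : (l.length : ℝ) < n := by exact_mod_cast h
  have : (n : ℝ) - l.length ≠ 0 := by linarith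
  simp [this]

lemma remainingProb_nonneg {n : ℕ} {l : List (Fin n)} (h : l.length ≤ n) (j : Fin n) :
    0 ≤ remainingProb l j := by
  have h' : (l.length : ℝ) ≤ n := by exact_mod_cast h
  unfold remainingProb
  split_ifs
  · exact le_rfl
  · exact one_div_nonneg.2 (by linarith)

lemma remainingProb_eq_zero {n : ℕ} {l : List (Fin n)} (hl : l.Nodup) (h : n ≤ l.length)
    (j : Fin n) : remainingProb l j = 0 := by
  have h' : l.length = n := le_antisymm (by simpa using hl.length_le_card) h
  simp [remainingProb, h']

/-- Only an inequality, because the mass is zero once `s > n`. -/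
lemma tsum_lawWithoutReplacement_le {n : ℕ} (s : ℕ) :
    ∑' l : List (Fin n), ENNReal.ofReal (lawWithoutReplacement s l) ≤ 1 := by
  induction s with
  | zero =>
    rw [tsum_list]
    simp [lawWithoutReplacement]
  | succ s ih =>
    rw [tsum_list]
    have h0 : lawWithoutReplacement (n := n) (s + 1) [] = 0 := by simp [lawWithoutReplacement]
    rw [h0, ENNReal.ofReal_zero, zero_add]
    refine le_trans (ENNReal.tsum_le_tsum fun l => ?_) ih
    simp_rw [lawWithoutReplacement_cons]
    by_cases hl : l.length = s ∧ l.Nodup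
    · rw [← ENNReal.ofReal_sum_of_nonneg]
      · refine ENNReal.ofReal_le_ofReal ?_
        rw [← Finset.mul_sum]
        refine mul_le_of_le_one_right (lawWithoutReplacement_nonneg s l) ?_
        rcases lt_or_ge l.length n with h | h
        · rw [sum_remainingProb hl.2 h]
        · simp [remainingProb_eq_zero hl.2 h]
      · exact fun j _ => mul_nonneg (lawWithoutReplacement_nonneg s l)
          (remainingProb_nonneg (by simpa using hl.2.length_le_card) j)
    · simp [lawWithoutReplacement, hl]

/-! ### Moment and tail bounds for sampled sums. -/

lemma smul_sub_sum_smul {ι : Type*} [Fintype ι] (q : ι → ℝ) (Y : ι → E d →L[ℝ] E d) (θ : ℝ)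
    (j : ι) : θ • (Y j - ∑ i, q i • Y i) = θ • Y j - ∑ i, q i • (θ • Y i) := by
  rw [smul_sub, Finset.smul_sum]
  congr 1
  exact Finset.sum_congr rfl fun i _ => smul_comm _ _ _

/-- The head is independent of the tail, so `sum_mul_trExp_le` costs one factor `exp (3/4 (θK)²)`
per draw, starting from `trExp 0 = d`. -/
lemma tsum_lawWithReplacement_mul_trExp_le {n : ℕ} {p : Fin n → ℝ} (hp : ∀ j, 0 ≤ p j)
    (hp1 : ∑ j, p j = 1) {Y : Fin n → E d →L[ℝ] E d} (hY : ∀ j, IsSymm (Y j)) {K : ℝ}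
    (hK : ∀ j, ‖Y j‖ ≤ K) {θ : ℝ} (hθ : (θ * K) ^ 2 ≤ 3) (s : ℕ) :
    ∑' l, ENNReal.ofReal (lawWithReplacement p s l *
      trExp (θ • (l.map fun j => Y j - ∑ i, p i • Y i).sum)) ≤
      ENNReal.ofReal (d * Real.exp (s * (3 / 4 * (θ * K) ^ 2))) := by
  set A := ∑ i, p i • Y i with hA
  have hAs : IsSymm A := IsSymm.sum _ fun i _ => (hY i).smul _
  have hθK : ∀ j, ‖θ • Y j‖ ≤ |θ| * K := fun j => by
    rw [norm_smul, Real.norm_eq_abs]; exact mul_le_mul_of_nonneg_left (hK j) (abs_nonneg _)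
  have hsq : (|θ| * K) ^ 2 = (θ * K) ^ 2 := by rw [mul_pow, sq_abs, mul_pow]
  induction s with
  | zero =>
    rw [tsum_list]
    have hz : θ • (0 : E d →L[ℝ] E d) = 0 := by ext; simp
    simp [lawWithReplacement, hz, trExp_zero]
  | succ s ih =>
    rw [tsum_list]
    have h0 : lawWithReplacement p (s + 1) [] = 0 := by simp [lawWithReplacement]
    rw [h0, zero_mul, ENNReal.ofReal_zero, zero_add]
    have hexp : (d : ℝ) * Real.exp ((s + 1 : ℕ) * (3 / 4 * (θ * K) ^ 2)) =
        Real.exp (3 / 4 * (θ * K) ^ 2) * (d * Real.exp (s * (3 / 4 * (θ * K) ^ 2))) := by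
      rw [show ((s + 1 : ℕ) : ℝ) * (3 / 4 * (θ * K) ^ 2) =
        3 / 4 * (θ * K) ^ 2 + s * (3 / 4 * (θ * K) ^ 2) by push_cast; ring, Real.exp_add]
      ring
    rw [hexp, ENNReal.ofReal_mul (Real.exp_pos _).le]
    refine le_trans ?_ (mul_le_mul_right ih _)
    rw [← ENNReal.tsum_mul_left]
    refine ENNReal.tsum_le_tsum fun l => ?_
    rw [← ENNReal.ofReal_mul (Real.exp_pos _).le, ← ENNReal.ofReal_sum_of_nonneg]
    · refine ENNReal.ofReal_le_ofReal ?_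
      set Z := (l.map fun j => Y j - A).sum with hZ
      have hZs : IsSymm Z := IsSymm.list_sum l fun j => (hY j).sub hAs
      have step := sum_mul_trExp_le hp hp1 (fun j => (hY j).smul θ) hθK (by rw [hsq]; exact hθ)
        (hZs.smul θ)
      rw [hsq] at step
      have := mul_le_mul_of_nonneg_left step (lawWithReplacement_nonneg hp s l)
      calc _ = lawWithReplacement p s l *
            ∑ j, p j * trExp (θ • Z + (θ • Y j - ∑ i, p i • (θ • Y i))) := by
            rw [Finset.mul_sum]
            refine Finset.sum_congr rfl fun j _ => ?_
            rw [lawWithReplacement_cons, List.map_cons, List.sum_cons, smul_add, ← hZ, hA,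
              smul_sub_sum_smul, add_comm, mul_assoc]
        _ ≤ _ := this
        _ = _ := by ring
    · exact fun j _ => mul_nonneg (lawWithReplacement_nonneg hp _ _) (trExp_nonneg _)

/-- After `s` draws with centred sum `Z`, the next draw has conditional mean `A - Z / (n - s)`. The
new centred sum is therefore `t • Z` plus a conditionally centred term, where `t = 1 - 1 / (n - s)`
lies in `[0, 1]`. By `trExp_smul_le` the shrinking replaces `trExp` by a convex combination with
`d`, which keeps the bound for independent draws. -/
lemma tsum_lawWithoutReplacement_mul_trExp_le {n : ℕ} (hn : 0 < n)
    {Y : Fin n → E d →L[ℝ] E d} (hY : ∀ j, IsSymm (Y j)) {K : ℝ}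
    (hK : ∀ j, ‖Y j‖ ≤ K) {θ : ℝ} (hθ : (θ * K) ^ 2 ≤ 3) (s : ℕ) :
    ∑' l, ENNReal.ofReal (lawWithoutReplacement s l *
      trExp (θ • (l.map fun j => Y j - ∑ i, (1 / (n : ℝ)) • Y i).sum)) ≤
      ENNReal.ofReal (d * Real.exp (s * (3 / 4 * (θ * K) ^ 2))) := by
  set A := ∑ i, (1 / (n : ℝ)) • Y i with hA
  have hn' : (n : ℝ) ≠ 0 := by positivity
  have hAs : IsSymm A := IsSymm.sum _ fun i _ => (hY i).smul _
  have hθK : ∀ j, ‖θ • Y j‖ ≤ |θ| * K := fun j => by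
    rw [norm_smul, Real.norm_eq_abs]; exact mul_le_mul_of_nonneg_left (hK j) (abs_nonneg _)
  have hsq : (|θ| * K) ^ 2 = (θ * K) ^ 2 := by rw [mul_pow, sq_abs, mul_pow]
  induction s with
  | zero =>
    rw [tsum_list]
    have hz : θ • (0 : E d →L[ℝ] E d) = 0 := by ext; simp
    simp [lawWithoutReplacement, hz, trExp_zero]
  | succ s ih =>
    rw [tsum_list]
    have h0 : lawWithoutReplacement (n := n) (s + 1) [] = 0 := by simp [lawWithoutReplacement]
    rw [h0, zero_mul, ENNReal.ofReal_zero, zero_add]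
    set e := Real.exp (s * (3 / 4 * (θ * K) ^ 2)) with he
    have he1 : 1 ≤ e := Real.one_le_exp (by positivity)
    have hexp : (d : ℝ) * Real.exp ((s + 1 : ℕ) * (3 / 4 * (θ * K) ^ 2)) =
        Real.exp (3 / 4 * (θ * K) ^ 2) * (d * e) := by
      rw [show ((s + 1 : ℕ) : ℝ) * (3 / 4 * (θ * K) ^ 2) =
        3 / 4 * (θ * K) ^ 2 + s * (3 / 4 * (θ * K) ^ 2) by push_cast; ring, Real.exp_add]
      ring
    rcases le_or_gt n s with hs | hs
    · have : ∀ l (j : Fin n), lawWithoutReplacement (s + 1) (j :: l) = 0 := fun l j => by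
        simp only [lawWithoutReplacement, ite_eq_right_iff]
        intro h
        have := h.2.length_le_card
        rw [h.1, Fintype.card_fin] at this
        omega
      simp [this]
    have hs' : (s : ℝ) + 1 ≤ n := by exact_mod_cast hs
    set t : ℝ := 1 - 1 / ((n : ℝ) - s) with ht
    have ht0 : 0 ≤ t := by
      rw [ht, sub_nonneg, div_le_one] <;> linarith
    have ht1 : t ≤ 1 := by
      have : 0 ≤ 1 / ((n : ℝ) - s) := one_div_nonneg.2 (by linarith)
      linarith
    rw [hexp, ENNReal.ofReal_mul (Real.exp_pos _).le]
    -- The convex combination of `d * e` and `d` is at most `d * e`, since `e ≥ 1`.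
    have hsplit : ENNReal.ofReal t * ENNReal.ofReal (d * e) +
        ENNReal.ofReal ((1 - t) * d) * 1 ≤ ENNReal.ofReal (d * e) := by
      rw [mul_one, ← ENNReal.ofReal_mul ht0, ← ENNReal.ofReal_add]
      · refine ENNReal.ofReal_le_ofReal ?_
        have : (d : ℝ) ≤ d * e := le_mul_of_one_le_right (by positivity) he1
        nlinarith [mul_le_mul_of_nonneg_left this (sub_nonneg.2 ht1)]
      · positivity
      · exact mul_nonneg (by linarith) (by positivity)
    refine le_trans ?_ (mul_le_mul_right hsplit _)
    refine le_trans ?_ (mul_le_mul_right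
      (add_le_add (mul_le_mul_right ih _) (mul_le_mul_right (tsum_lawWithoutReplacement_le (n := n) s) _)) _)
    rw [← ENNReal.tsum_mul_left, ← ENNReal.tsum_mul_left, ← ENNReal.tsum_add,
      ← ENNReal.tsum_mul_left]
    refine ENNReal.tsum_le_tsum fun l => ?_
    by_cases hl : l.length = s ∧ l.Nodup
    swap
    · have h1 : lawWithoutReplacement s l = 0 := if_neg hl
      simp [lawWithoutReplacement_cons, h1]
    have hlaw := lawWithoutReplacement_nonneg s l
    rw [← ENNReal.ofReal_mul ht0, ← ENNReal.ofReal_mul (mul_nonneg (by linarith) (by positivity)),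
      ← ENNReal.ofReal_add (mul_nonneg ht0 (mul_nonneg hlaw (trExp_nonneg _)))
        (mul_nonneg (mul_nonneg (by linarith) (by positivity)) hlaw),
      ← ENNReal.ofReal_mul (Real.exp_pos _).le, ← ENNReal.ofReal_sum_of_nonneg]
    · refine ENNReal.ofReal_le_ofReal ?_
      set Z := (l.map fun j => Y j - A).sum with hZ
      have hZs : IsSymm Z := IsSymm.list_sum l fun j => (hY j).sub hAs
      have hlen : l.length < n := by rw [hl.1]; exact hs
      have step := sum_mul_trExp_le (remainingProb_nonneg hlen.le) (sum_remainingProb hl.2 hlen)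
        (fun j => (hY j).smul θ) hθK (by rw [hsq]; exact hθ) ((hZs.smul θ).smul t)
      rw [hsq] at step
      have hns : (n : ℝ) - s ≠ 0 := by linarith
      have hmean : ∑ i, remainingProb l i • Y i = A - (1 / ((n : ℝ) - s)) • Z := by
        refine (sum_remainingProb_smul hl.2 Y).trans ?_
        rw [hl.1]
        have e1 : ∑ j, Y j = (n : ℝ) • A := by
          rw [hA, ← Finset.smul_sum, smul_smul, mul_one_div_cancel hn', one_smul]
        have e2 : Z = (l.map Y).sum - (s : ℝ) • A := by
          rw [hZ, ← hl.1]
          exact sum_map_sub_const l Y A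
        rw [e1, e2]
        have e3 : (1 / ((n : ℝ) - s)) * n = 1 + (1 / ((n : ℝ) - s)) * s := by field_simp; ring
        have e4 : (1 / ((n : ℝ) - s)) • ((n : ℝ) • A) = (1 + (1 / ((n : ℝ) - s)) * s) • A := by
          rw [smul_smul, e3]
        rw [smul_sub, e4]
        module
      have hstep : ∀ j, θ • (Y j - A + Z) =
          t • (θ • Z) + (θ • Y j - ∑ i, remainingProb l i • (θ • Y i)) := fun j => by
        rw [← smul_sub_sum_smul, hmean, ht]
        module
      calc _ = lawWithoutReplacement s l * ∑ j, remainingProb l j *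
            trExp (t • (θ • Z) + (θ • Y j - ∑ i, remainingProb l i • (θ • Y i))) := by
            rw [Finset.mul_sum]
            refine Finset.sum_congr rfl fun j _ => ?_
            rw [lawWithoutReplacement_cons, List.map_cons, List.sum_cons, ← hZ, hstep, mul_assoc]
        _ ≤ lawWithoutReplacement s l *
            (Real.exp (3 / 4 * (θ * K) ^ 2) * (t * trExp (θ • Z) + (1 - t) * d)) :=
            mul_le_mul_of_nonneg_left (step.trans (mul_le_mul_of_nonneg_left
              (trExp_smul_le (hZs.smul θ) ht0 ht1) (Real.exp_pos _).le)) hlaw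
        _ = _ := by ring
    · exact fun j _ => mul_nonneg (lawWithoutReplacement_nonneg _ _) (trExp_nonneg _)

lemma exists_inner_of_lt_norm {T : E d →L[ℝ] E d} (hT : IsSymm T) {r : ℝ} (hr : 0 ≤ r)
    (h : r < ‖T‖) : ∃ v : E d, ‖v‖ = 1 ∧ r < |inner ℝ v (T v)| := by
  obtain ⟨u, m, hu, -⟩ := exists_eigenbasis hT
  by_contra! hc
  refine absurd h (not_lt.2 (T.opNorm_le_bound hr fun x => ?_))
  have h1 : ‖T x‖ ^ 2 ≤ (r * ‖x‖) ^ 2 := by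
    rw [← sum_inner_sq_left u, mul_pow, ← sum_inner_sq_left u x, Finset.mul_sum]
    refine Finset.sum_le_sum fun b _ => ?_
    have e : inner ℝ (u b) (T x) = m b * inner ℝ (u b) x := by
      rw [show inner ℝ (u b) (T x) = inner ℝ (T (u b)) x from (hT (u b) x).symm, hu,
        real_inner_smul_left]
    have hb := hc (u b) (by simp)
    rw [hu, real_inner_smul_right, real_inner_self_eq_norm_sq] at hb
    simp only [OrthonormalBasis.norm_eq_one, one_pow, mul_one] at hb
    rw [e, mul_pow]
    exact mul_le_mul_of_nonneg_right (sq_le_sq' (abs_le.1 hb).1 (abs_le.1 hb).2) (sq_nonneg _)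
  exact abs_le_of_sq_le_sq' h1 (by positivity) |>.2

lemma norm_list_sum_le {ι V : Type*} [SeminormedAddCommGroup V] (l : List ι) (g : ι → V) {c : ℝ}
    (h : ∀ i, ‖g i‖ ≤ c) : ‖(l.map g).sum‖ ≤ l.length * c := by
  induction l with
  | nil => simp
  | cons j l ih =>
    simp only [List.map_cons, List.sum_cons, List.length_cons, Nat.cast_add, Nat.cast_one]
    linarith [norm_add_le (g j) (l.map g).sum, h j]

open Classical in
/-- Tail bound for the mean of a sample from the trace-exponential moment bound. -/
lemma tsum_tail_le {ι : Type*} (hd : 0 < d) {law : List ι → ℝ} (hlaw : ∀ l, 0 ≤ law l) {s : ℕ}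
    (hs : 0 < s) (hlen : ∀ l, l.length ≠ s → law l = 0) {X : ι → E d →L[ℝ] E d}
    (hX : ∀ j, IsSymm (X j)) {K : ℝ} (hXK : ∀ j, ‖X j‖ ≤ 2 * K)
    (hmgf : ∀ θ : ℝ, (θ * K) ^ 2 ≤ 3 → ∑' l, ENNReal.ofReal (law l * trExp (θ • (l.map X).sum)) ≤
      ENNReal.ofReal (d * Real.exp (s * (3 / 4 * (θ * K) ^ 2))))
    {ε δ₀ : ℝ} (hε : 0 < ε) (hδ : 0 < δ₀) (hδ1 : δ₀ < 1)
    (hsize : 4 * K ^ 2 / ε ^ 2 * Real.log (2 * d / δ₀) ≤ s) :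
    ∑' l, (if ε < ‖(1 / (l.length : ℝ)) • (l.map X).sum‖ then ENNReal.ofReal (law l) else 0) ≤
      ENNReal.ofReal (δ₀ ^ (4 / 3 : ℝ)) := by
  have hs' : (0 : ℝ) < s := by exact_mod_cast hs
  have hd' : (1 : ℝ) ≤ d := by exact_mod_cast hd
  -- For `2K ≤ ε` a deviation above `ε` is impossible; otherwise `ε < 2K` keeps `θK ≤ 4/3`, inside
  -- the range of the moment bound.
  rcases le_or_gt (2 * K) ε with hεK | hεK
  · have : ∀ l : List ι, (if ε < ‖(1 / (l.length : ℝ)) • (l.map X).sum‖ then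
        ENNReal.ofReal (law l) else 0) = 0 := fun l => by
      rw [ite_eq_right_iff]
      intro h
      by_cases hl : l.length = s
      · refine absurd h (not_lt.2 (le_trans ?_ hεK))
        rw [norm_smul, hl, Real.norm_of_nonneg (by positivity)]
        have := norm_list_sum_le l X hXK
        rw [hl] at this
        calc _ ≤ 1 / (s : ℝ) * (s * (2 * K)) := by gcongr
          _ = _ := by field_simp
      · rw [hlen l hl, ENNReal.ofReal_zero]
    rw [ENNReal.tsum_eq_zero.2 this]
    exact zero_le
  have hK : 0 < K := by linarith
  -- The minimiser of `-θ ε + (3/4) θ² K²`, with minimum `-ε² / (3K²)`.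
  set θ := 2 * ε / (3 * K ^ 2) with hθ
  have hθ0 : 0 < θ := by positivity
  have hθK : (θ * K) ^ 2 ≤ 3 := by
    have h1 : θ * K = 2 * ε / (3 * K) := by rw [hθ]; field_simp
    have h2 : θ * K ≤ 4 / 3 := by
      rw [h1, div_le_div_iff₀ (by positivity) (by norm_num)]; linarith
    have : 0 ≤ θ * K := by positivity
    nlinarith
  have hpt : ∀ l, (if ε < ‖(1 / (l.length : ℝ)) • (l.map X).sum‖ then
      ENNReal.ofReal (law l) else 0) ≤ ENNReal.ofReal (Real.exp (-(θ * (s * ε)))) *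
        (ENNReal.ofReal (law l * trExp (θ • (l.map X).sum)) +
          ENNReal.ofReal (law l * trExp ((-θ) • (l.map X).sum))) := fun l => by
    split_ifs with h
    swap
    · exact zero_le
    by_cases hl : l.length = s
    swap
    · simp [hlen l hl]
    have hZs : IsSymm (l.map X).sum := IsSymm.list_sum l hX
    rw [← ENNReal.ofReal_add (mul_nonneg (hlaw l) (trExp_nonneg _))
      (mul_nonneg (hlaw l) (trExp_nonneg _)), ← ENNReal.ofReal_mul (Real.exp_pos _).le]
    refine ENNReal.ofReal_le_ofReal ?_
    set Z := (l.map X).sum with hZ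
    have h' : s * ε < ‖Z‖ := by
      rw [norm_smul, hl, Real.norm_of_nonneg (by positivity), one_div, inv_mul_eq_div,
        lt_div_iff₀ hs'] at h
      linarith
    obtain ⟨v, hv, hvr⟩ := exists_inner_of_lt_norm hZs (by positivity) h'
    have key : Real.exp (θ * (s * ε)) ≤ trExp (θ • Z) + trExp ((-θ) • Z) := by
      rcases lt_abs.1 hvr with h2 | h2
      · have h3 := exp_inner_le_trExp (hZs.smul θ) hv
        have h4 : Real.exp (θ * (s * ε)) ≤ Real.exp (inner ℝ v ((θ • Z) v)) := by
          rw [_root_.smul_apply, real_inner_smul_right]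
          exact Real.exp_le_exp.2 (mul_le_mul_of_nonneg_left h2.le hθ0.le)
        linarith [trExp_nonneg ((-θ) • Z)]
      · have h3 := exp_inner_le_trExp (hZs.smul (-θ)) hv
        have h4 : Real.exp (θ * (s * ε)) ≤ Real.exp (inner ℝ v (((-θ) • Z) v)) := by
          rw [_root_.smul_apply, real_inner_smul_right]
          refine Real.exp_le_exp.2 ?_
          have := mul_le_mul_of_nonneg_left h2.le hθ0.le
          linarith
        linarith [trExp_nonneg (θ • Z)]
    have : 1 ≤ Real.exp (-(θ * (s * ε))) * (trExp (θ • Z) + trExp ((-θ) • Z)) := by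
      calc (1 : ℝ) = Real.exp (-(θ * (s * ε))) * Real.exp (θ * (s * ε)) := by
            rw [← Real.exp_add]; simp
        _ ≤ _ := by gcongr
    calc law l = law l * 1 := (mul_one _).symm
      _ ≤ law l * (Real.exp (-(θ * (s * ε))) * (trExp (θ • Z) + trExp ((-θ) • Z))) :=
          mul_le_mul_of_nonneg_left this (hlaw l)
      _ = _ := by ring
  refine (ENNReal.tsum_le_tsum hpt).trans ?_
  rw [ENNReal.tsum_mul_left, ENNReal.tsum_add]
  refine (mul_le_mul_right (add_le_add (hmgf θ hθK) (hmgf (-θ) (by simpa using hθK))) _).trans ?_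
  rw [← ENNReal.ofReal_add (by positivity) (by positivity), ← ENNReal.ofReal_mul (by positivity)]
  refine ENNReal.ofReal_le_ofReal ?_
  have e1 : Real.exp (-(θ * (s * ε))) * (d * Real.exp (s * (3 / 4 * (θ * K) ^ 2)) +
      d * Real.exp (s * (3 / 4 * (-θ * K) ^ 2))) =
      2 * d * Real.exp (-(s * ε ^ 2 / (3 * K ^ 2))) := by
    have e0 : -(s * ε ^ 2 / (3 * K ^ 2)) = -(θ * (s * ε)) + s * (3 / 4 * (θ * K) ^ 2) := by
      rw [hθ]; field_simp; ring
    rw [neg_mul, neg_sq, e0, Real.exp_add]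
    ring
  rw [e1]
  have hq : 0 < 2 * (d : ℝ) / δ₀ := by positivity
  -- The constant `4` of the sample size against the `3` of the tail gives the surplus exponent
  -- `4/3`; the leftover power `(2d) ^ (-1/3)` is at most `1`.
  have e2 : 4 / 3 * Real.log (2 * d / δ₀) ≤ s * ε ^ 2 / (3 * K ^ 2) := by
    rw [le_div_iff₀ (by positivity)]
    rw [div_mul_eq_mul_div, div_le_iff₀ (by positivity)] at hsize
    linarith
  calc 2 * d * Real.exp (-(s * ε ^ 2 / (3 * K ^ 2)))
      ≤ 2 * d * Real.exp (-(4 / 3 * Real.log (2 * d / δ₀))) := by gcongr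
    _ = 2 * d * (2 * d / δ₀) ^ (-(4 / 3) : ℝ) := by
        rw [Real.rpow_def_of_pos hq]; congr 2; ring
    _ = (2 * d * (2 * d) ^ (-(4 / 3) : ℝ)) * δ₀ ^ (4 / 3 : ℝ) := by
        rw [Real.div_rpow (by positivity) hδ.le, Real.rpow_neg hδ.le, div_inv_eq_mul, mul_assoc (2 * (d : ℝ))]
    _ = (2 * d : ℝ) ^ (-(1 / 3) : ℝ) * δ₀ ^ (4 / 3 : ℝ) := by
        congr 1
        have h2d : (0 : ℝ) < 2 * d := by positivity
        nth_rw 1 [← Real.rpow_one (2 * d : ℝ)]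
        rw [← Real.rpow_add h2d]; norm_num
    _ ≤ 1 * δ₀ ^ (4 / 3 : ℝ) := by
        gcongr
        exact Real.rpow_le_one_of_one_le_of_nonpos (by linarith) (by norm_num)
    _ = _ := one_mul _

/-! ### Gradients and Hessians of finite sums and ridge functions. -/

lemma fderiv_eq_innerSL_gradient (f : E d → ℝ) (x : E d) :
    fderiv ℝ f x = innerSL ℝ (gradient f x) := by
  ext v
  simp [gradient]

lemma hasFDerivAt_gradient {f : E d → ℝ} (hf : TwiceDifferentiable f) (x : E d) :
    HasFDerivAt f (innerSL ℝ (gradient f x)) x := by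
  rw [← fderiv_eq_innerSL_gradient]
  exact (hf.1 x).hasFDerivAt

lemma gradient_eq_of_hasFDerivAt {f : E d → ℝ} {x g : E d} (h : HasFDerivAt f (innerSL ℝ g) x) :
    gradient f x = g := by
  have := h.fderiv
  rw [fderiv_eq_innerSL_gradient] at this
  refine ext_inner_right ℝ fun v => ?_
  simpa using congrArg (fun T => T v) this

lemma TwiceDifferentiable.hasFDerivAt_hess {f : E d → ℝ} (hf : TwiceDifferentiable f) (x : E d) :
    HasFDerivAt (gradient f) (hess f x) x := (hf.2 x).hasFDerivAt

lemma TwiceDifferentiable.isSymm_hess {f : E d → ℝ} (hf : TwiceDifferentiable f) (x : E d) :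
    IsSymm (hess f x) := fun v w => by
  have h2 : HasFDerivAt (fun y => innerSL ℝ (gradient f y)) ((innerSL ℝ).comp (hess f x)) x :=
    (innerSL ℝ (E := E d)).hasFDerivAt.comp x (hf.hasFDerivAt_hess x)
  have h := second_derivative_symmetric (hasFDerivAt_gradient hf) h2 v w
  simp only [ContinuousLinearMap.comp_apply, innerSL_apply_apply] at h
  exact h.trans (real_inner_comm _ _)

lemma gradient_finiteSum {n : ℕ} {f : Fin n → E d → ℝ} (hf : ∀ i, TwiceDifferentiable (f i))
    (x : E d) : gradient (finiteSum f) x = (1 / (n : ℝ)) • ∑ i, gradient (f i) x := by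
  refine gradient_eq_of_hasFDerivAt ?_
  have := (HasFDerivAt.fun_sum (u := Finset.univ)
    fun i _ => hasFDerivAt_gradient (hf i) x).const_mul (1 / (n : ℝ))
  have h : innerSL ℝ ((1 / (n : ℝ)) • ∑ i, gradient (f i) x) =
      (1 / (n : ℝ)) • ∑ i, innerSL ℝ (gradient (f i) x) := by
    ext v
    simp
  rw [h]
  exact this

lemma hess_finiteSum {n : ℕ} {f : Fin n → E d → ℝ} (hf : ∀ i, TwiceDifferentiable (f i))
    (x : E d) : HasFDerivAt (gradient (finiteSum f)) ((1 / (n : ℝ)) • ∑ i, hess (f i) x) x := by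
  rw [show gradient (finiteSum f) = fun x => (1 / (n : ℝ)) • ∑ i, gradient (f i) x from
    funext (gradient_finiteSum hf)]
  exact (HasFDerivAt.fun_sum (u := Finset.univ)
    fun i _ => (hf i).hasFDerivAt_hess x).const_smul (1 / (n : ℝ))

lemma twiceDifferentiable_finiteSum {n : ℕ} {f : Fin n → E d → ℝ}
    (hf : ∀ i, TwiceDifferentiable (f i)) : TwiceDifferentiable (finiteSum f) :=
  ⟨fun x => ((HasFDerivAt.fun_sum (u := Finset.univ)
    fun i _ => hasFDerivAt_gradient (hf i) x).const_mul (1 / (n : ℝ))).differentiableAt,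
    fun x => (hess_finiteSum hf x).differentiableAt⟩

/-- The Hessian is the rank-one operator `φ'' a aᵀ`. Regularity of `φ i` is not assumed: for `a i ≠
0` it is recovered by restricting the ridge function to the line spanned by `a i`, and for `a i = 0`
both sides vanish. -/
lemma norm_hess_ridge {n : ℕ} {φ : Fin n → ℝ → ℝ} {a : Fin n → E d} {i : Fin n}
    (h : TwiceDifferentiable (ridge φ a i)) (x : E d) :
    ‖hess (ridge φ a i) x‖ = weight φ a x i := by
  rcases eq_or_ne (a i) 0 with ha | ha
  · have : gradient (ridge φ a i) = fun _ => 0 := by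
      funext y
      refine gradient_eq_of_hasFDerivAt ?_
      have : HasFDerivAt (fun _ : E d => φ i 0) (0 : E d →L[ℝ] ℝ) y := hasFDerivAt_const _ _
      have h0 : ridge φ a i = fun _ => φ i 0 := by funext z; simp [ridge, ha]
      rw [map_zero, h0]
      exact this
    simp [hess, this, weight, ha]
  have hn : ‖a i‖ ^ 2 ≠ 0 := pow_ne_zero 2 (norm_ne_zero_iff.2 ha)
  let c : ℝ → E d := fun t => (t / ‖a i‖ ^ 2) • a i
  have hc : ∀ t, inner ℝ (a i) (c t) = t := fun t => by
    simp only [c]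
    rw [real_inner_smul_right, real_inner_self_eq_norm_sq, div_mul_cancel₀ _ hn]
  have hcd : Differentiable ℝ c := by
    simp only [c]; fun_prop
  have hφ : φ i = fun t => ridge φ a i (c t) := by
    funext t; simp [ridge, hc]
  have hφd : Differentiable ℝ (φ i) := by
    rw [hφ]; exact h.1.comp hcd
  have hgrad : ∀ y, gradient (ridge φ a i) y = deriv (φ i) (inner ℝ (a i) y) • a i := fun y => by
    refine gradient_eq_of_hasFDerivAt ?_
    have h1 : HasFDerivAt (fun y => inner ℝ (a i) y) (innerSL ℝ (a i)) y :=
      (innerSL ℝ (a i)).hasFDerivAt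
    have := (hφd (inner ℝ (a i) y)).hasDerivAt.comp_hasFDerivAt y h1
    rw [map_smul]
    exact this
  have hφ' : deriv (φ i) = fun t => inner ℝ (a i) (gradient (ridge φ a i) (c t)) / ‖a i‖ ^ 2 := by
    funext t
    rw [hgrad, hc, real_inner_smul_right, real_inner_self_eq_norm_sq, mul_div_cancel_right₀ _ hn]
  have hφ'd : Differentiable ℝ (deriv (φ i)) := by
    rw [hφ']
    exact ((differentiable_const _).inner ℝ (h.2.comp hcd)).div_const _
  have hhess : hess (ridge φ a i) x =
      (deriv (deriv (φ i)) (inner ℝ (a i) x) • innerSL ℝ (a i)).smulRight (a i) := by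
    unfold hess
    rw [show gradient (ridge φ a i) = fun y => deriv (φ i) (inner ℝ (a i) y) • a i from
      funext hgrad]
    have h1 : HasFDerivAt (fun y => inner ℝ (a i) y) (innerSL ℝ (a i)) x :=
      (innerSL ℝ (a i)).hasFDerivAt
    exact (((hφ'd (inner ℝ (a i) x)).hasDerivAt.comp_hasFDerivAt x h1).smul_const (a i)).fderiv
  rw [hhess, ContinuousLinearMap.norm_smulRight_apply, norm_smul, innerSL_apply_norm, weight,
    Real.norm_eq_abs]
  ring

lemma weight_nonneg {n : ℕ} (φ : Fin n → ℝ → ℝ) (a : Fin n → E d) (x : E d) (i : Fin n) :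
    0 ≤ weight φ a x i := by unfold weight; positivity

/-! ### Accuracy of the sub-sampled Hessian for the three strategies. -/

namespace Sampling

variable {n : ℕ} {f : Fin n → E d → ℝ}

lemma prob_nonneg (σ : Sampling f) (x : E d) (j : Fin n) : 0 ≤ σ.prob x j := by
  cases σ with
  | uniformWithReplacement => simp [prob]
  | uniformWithoutReplacement => simp [prob]
  | nonuniform φ a =>
    simp only [prob, nonuniformProb]
    split_ifs
    · positivity
    · exact div_nonneg (weight_nonneg _ _ _ _) (Finset.sum_nonneg fun i _ => weight_nonneg _ _ _ _)

lemma sum_prob (σ : Sampling f) (hn : 0 < n) (x : E d) : ∑ j, σ.prob x j = 1 := by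
  have hn' : (n : ℝ) ≠ 0 := by positivity
  cases σ with
  | uniformWithReplacement => simp [prob, hn']
  | uniformWithoutReplacement => simp [prob, hn']
  | nonuniform φ a =>
    simp only [prob, nonuniformProb]
    split_ifs with h
    · simp [hn']
    · rw [← Finset.sum_div, div_self h]

lemma law_nonneg (σ : Sampling f) (x : E d) (s : ℕ) (l : List (Fin n)) : 0 ≤ σ.law x s l := by
  cases σ with
  | uniformWithReplacement => exact lawWithReplacement_nonneg (fun _ => by positivity) s l
  | uniformWithoutReplacement => exact lawWithoutReplacement_nonneg s l
  | nonuniform φ a =>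
    exact lawWithReplacement_nonneg (fun j => prob_nonneg (nonuniform φ a) x j) s l

lemma law_eq_zero (σ : Sampling f) (x : E d) {s : ℕ} {l : List (Fin n)} (h : l.length ≠ s) :
    σ.law x s l = 0 := by
  cases σ <;> simp [law, lawWithReplacement, lawWithoutReplacement, h]

/-- The contribution of the index `j` to the sub-sampled Hessian. -/
noncomputable def summand (σ : Sampling f) (x : E d) (j : Fin n) : E d →L[ℝ] E d :=
  (1 / ((n : ℝ) * σ.prob x j)) • hess (f j) x

lemma subHess_eq (σ : Sampling f) (x : E d) (l : List (Fin n)) :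
    subHess f (σ.prob x) l x = (1 / (l.length : ℝ)) • (l.map (σ.summand x)).sum := by
  have : (l.map (σ.summand x)).sum =
      (1 / (n : ℝ)) • (l.map fun j => (1 / σ.prob x j) • hess (f j) x).sum := by
    rw [List.smul_sum, List.map_map]
    congr 2
    funext j
    simp only [summand, Function.comp, smul_smul]
    congr 1
    ring
  rw [this, subHess, smul_smul]
  congr 1
  ring

lemma summand_uniform (hn : 0 < n) (f : Fin n → E d → ℝ) (x : E d) (j : Fin n) :
    (uniformWithReplacement f).summand x j = hess (f j) x := by
  have hn' : (n : ℝ) ≠ 0 := by positivity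
  simp [summand, prob, hn']

lemma isSymm_summand (σ : Sampling f) (hf : ∀ i, TwiceDifferentiable (f i)) (x : E d)
    (j : Fin n) : IsSymm (σ.summand x j) := ((hf j).isSymm_hess x).smul _

lemma le_bound_uniform {K : Fin n → ℝ} (i : Fin n) : K i ≤ ⨆ i, K i :=
  le_ciSup (Set.finite_range K).bddAbove i

/-- For non-uniform sampling, dividing by `n p j` turns every nonzero Hessian into one of norm
exactly the mean weight, which is why the mean of the `K i` replaces their maximum. -/
lemma norm_summand_le (σ : Sampling f) (hn : 0 < n) (hf : ∀ i, TwiceDifferentiable (f i))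
    {K : Fin n → ℝ} (x : E d) (hK : ∀ i, ‖hess (f i) x‖ ≤ K i) (j : Fin n) :
    ‖σ.summand x j‖ ≤ σ.bound K := by
  cases σ with
  | uniformWithReplacement =>
    rw [summand_uniform hn]; exact (hK j).trans (le_bound_uniform j)
  | uniformWithoutReplacement =>
    have := summand_uniform hn f x j
    exact (this ▸ (hK j).trans (le_bound_uniform j) :)
  | nonuniform φ a =>
    have hw : ∀ i, weight φ a x i ≤ K i := fun i => by rw [← norm_hess_ridge (hf i)]; exact hK i
    have hsum : ∑ i, weight φ a x i ≤ ∑ i, K i := Finset.sum_le_sum fun i _ => hw i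
    have hnn : 0 ≤ ∑ i, weight φ a x i := Finset.sum_nonneg fun i _ => weight_nonneg _ _ _ _
    simp only [bound, summand]
    rw [norm_smul, norm_hess_ridge (hf j), Real.norm_of_nonneg
      (one_div_nonneg.2 (mul_nonneg (by positivity) (prob_nonneg _ _ _)))]
    rcases (weight_nonneg φ a x j).eq_or_lt with h0 | h0
    · rw [← h0, mul_zero]
      exact mul_nonneg (by positivity) (hnn.trans hsum)
    · have hW : ∑ i, weight φ a x i ≠ 0 := fun h => by
        rw [Finset.sum_eq_zero_iff_of_nonneg fun i _ => weight_nonneg _ _ _ _] at h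
        exact h0.ne' (h j (Finset.mem_univ j))
      simp only [prob, nonuniformProb, if_neg hW]
      calc _ = 1 / (n : ℝ) * ∑ i, weight φ a x i := by field_simp
        _ ≤ _ := by gcongr

/-- Unbiasedness: an index of probability zero has a vanishing Hessian, so nothing is lost by never
drawing it. -/
lemma sum_prob_smul_summand (σ : Sampling f) (hn : 0 < n) (hf : ∀ i, TwiceDifferentiable (f i))
    (x : E d) : ∑ j, σ.prob x j • σ.summand x j = hess (finiteSum f) x := by
  have hn' : (n : ℝ) ≠ 0 := by positivity
  rw [hess, (hess_finiteSum hf x).fderiv, Finset.smul_sum]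
  refine Finset.sum_congr rfl fun j _ => ?_
  rw [summand, smul_smul]
  by_cases h : σ.prob x j = 0
  · have : hess (f j) x = 0 := by
      cases σ with
      | uniformWithReplacement => simp [prob, hn'] at h
      | uniformWithoutReplacement => simp [prob, hn'] at h
      | nonuniform φ a =>
        rw [← norm_eq_zero, norm_hess_ridge (hf j)]
        simp only [prob, nonuniformProb] at h
        split_ifs at h with hW
        · simp [hn'] at h
        · exact (div_eq_zero_iff.1 h).resolve_right hW
    rw [this]
    ext; simp
  · congr 1
    field_simp

lemma bound_nonneg (σ : Sampling f) (hn : 0 < n) {K : Fin n → ℝ} {x : E d}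
    (hK : ∀ i, ‖hess (f i) x‖ ≤ K i) : 0 ≤ σ.bound K := by
  have h0 : ∀ i, 0 ≤ K i := fun i => (norm_nonneg _).trans (hK i)
  cases σ with
  | uniformWithReplacement => exact (h0 ⟨0, hn⟩).trans (le_bound_uniform _)
  | uniformWithoutReplacement => exact (h0 ⟨0, hn⟩).trans (le_bound_uniform _)
  | nonuniform φ a => exact mul_nonneg (by positivity) (Finset.sum_nonneg fun i _ => h0 i)

/-- The constant `4` suffices for all strategies; the `16` of uniform sampling is weakened to it. -/
lemma le_requiredSize (σ : Sampling f) (K : Fin n → ℝ) {ε δ₀ : ℝ}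
    (hlog : 0 ≤ Real.log (2 * d / δ₀)) :
    4 * σ.bound K ^ 2 / ε ^ 2 * Real.log (2 * d / δ₀) ≤ σ.requiredSize K ε δ₀ := by
  have key : ∀ r : ℝ, 4 * r ^ 2 / ε ^ 2 * Real.log (2 * d / δ₀) ≤
      16 * r ^ 2 / ε ^ 2 * Real.log (2 * d / δ₀) := fun r => by
    gcongr; norm_num
  cases σ with
  | uniformWithReplacement => exact key _
  | uniformWithoutReplacement => exact key _
  | nonuniform φ a => exact le_rfl

/-- A surely valid bound, which makes the step count depend on `σ.bound K` alone. The empty list is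
covered because `1 / 0 = 0`. -/
lemma norm_subHess_le (σ : Sampling f) (hn : 0 < n) (hf : ∀ i, TwiceDifferentiable (f i))
    {K : Fin n → ℝ} (x : E d) (hK : ∀ i, ‖hess (f i) x‖ ≤ K i) (l : List (Fin n)) :
    ‖subHess f (σ.prob x) l x‖ ≤ σ.bound K := by
  rw [subHess_eq, norm_smul, Real.norm_of_nonneg (by positivity)]
  have h := norm_list_sum_le l (σ.summand x) (σ.norm_summand_le hn hf x hK)
  rcases Nat.eq_zero_or_pos l.length with h0 | h0
  · simpa [h0] using σ.bound_nonneg hn hK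
  · have : (0 : ℝ) < l.length := by exact_mod_cast h0
    calc _ ≤ 1 / (l.length : ℝ) * (l.length * σ.bound K) := by gcongr
      _ = _ := by field_simp

lemma isSymm_subHess (σ : Sampling f) (hf : ∀ i, TwiceDifferentiable (f i)) (x : E d)
    (l : List (Fin n)) : IsSymm (subHess f (σ.prob x) l x) := by
  rw [subHess_eq]
  exact (IsSymm.list_sum l (σ.isSymm_summand hf x)).smul _

lemma tsum_law_mul_trExp_le (σ : Sampling f) (hn : 0 < n) (hf : ∀ i, TwiceDifferentiable (f i))
    {K : Fin n → ℝ} (x : E d) (hK : ∀ i, ‖hess (f i) x‖ ≤ K i) {θ : ℝ}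
    (hθ : (θ * σ.bound K) ^ 2 ≤ 3) (s : ℕ) :
    ∑' l, ENNReal.ofReal (σ.law x s l *
      trExp (θ • (l.map fun j => σ.summand x j - hess (finiteSum f) x).sum)) ≤
      ENNReal.ofReal (d * Real.exp (s * (3 / 4 * (θ * σ.bound K) ^ 2))) := by
  have hY := σ.isSymm_summand hf x
  have hYK := σ.norm_summand_le hn hf x hK
  rw [← σ.sum_prob_smul_summand hn hf x]
  cases σ with
  | uniformWithReplacement =>
    exact tsum_lawWithReplacement_mul_trExp_le (prob_nonneg (uniformWithReplacement f) x)
      (sum_prob (uniformWithReplacement f) hn x) hY hYK hθ s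
  | uniformWithoutReplacement =>
    exact tsum_lawWithoutReplacement_mul_trExp_le hn hY hYK hθ s
  | nonuniform φ a =>
    exact tsum_lawWithReplacement_mul_trExp_le (prob_nonneg (nonuniform φ a) x)
      (sum_prob (nonuniform φ a) hn x) hY hYK hθ s

open Classical in
/-- The sub-sampled Hessian has accuracy `ε` up to probability `δ₀ ^ (4 / 3)`. -/
lemma tsum_law_bad_le (σ : Sampling f) (hn : 0 < n) (hd : 0 < d)
    (hf : ∀ i, TwiceDifferentiable (f i)) {K : Fin n → ℝ} (x : E d)
    (hK : ∀ i, ‖hess (f i) x‖ ≤ K i) {ε δ₀ : ℝ} (hε : 0 < ε) (hδ : 0 < δ₀) (hδ1 : δ₀ < 1)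
    {s : ℕ} (hs : 0 < s) (hsize : σ.requiredSize K ε δ₀ ≤ s) :
    ∑' l, (if ε < ‖subHess f (σ.prob x) l x - hess (finiteSum f) x‖ then
      ENNReal.ofReal (σ.law x s l) else 0) ≤ ENNReal.ofReal (δ₀ ^ (4 / 3 : ℝ)) := by
  have hd' : (1 : ℝ) ≤ d := by exact_mod_cast hd
  have hlog : 0 ≤ Real.log (2 * d / δ₀) := by
    refine Real.log_nonneg ?_
    rw [le_div_iff₀ hδ]; linarith
  set A := hess (finiteSum f) x with hA
  have hAs : IsSymm A := (twiceDifferentiable_finiteSum hf).isSymm_hess x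
  have hAK : ‖A‖ ≤ σ.bound K := by
    rw [hA, ← σ.sum_prob_smul_summand hn hf x]
    calc _ ≤ ∑ j, ‖σ.prob x j • σ.summand x j‖ := norm_sum_le _ _
      _ ≤ ∑ j, σ.prob x j * σ.bound K := by
          refine Finset.sum_le_sum fun j _ => ?_
          rw [norm_smul, Real.norm_of_nonneg (σ.prob_nonneg x j)]
          exact mul_le_mul_of_nonneg_left (σ.norm_summand_le hn hf x hK j) (σ.prob_nonneg x j)
      _ = _ := by rw [← Finset.sum_mul, σ.sum_prob hn, one_mul]
  refine le_trans (ENNReal.tsum_le_tsum fun l => ?_)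
    (tsum_tail_le hd (σ.law_nonneg x s) hs (fun l hl => σ.law_eq_zero x hl)
      (X := fun j => σ.summand x j - A) (fun j => (σ.isSymm_summand hf x j).sub hAs)
      (K := σ.bound K) (fun j => ?_) (fun θ hθ => σ.tsum_law_mul_trExp_le hn hf x hK hθ s)
      hε hδ hδ1 ((σ.le_requiredSize K hlog).trans hsize))
  · by_cases hl : l.length = s
    · refine le_of_eq ?_
      have hl0 : (l.length : ℝ) ≠ 0 := by rw [hl]; positivity
      have : (l.map fun j => σ.summand x j - A).sum =
          (l.map (σ.summand x)).sum - (l.length : ℝ) • A :=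
        sum_map_sub_const l _ A
      rw [this, subHess_eq, smul_sub, smul_smul, one_div_mul_cancel hl0, one_smul]
    · simp [σ.law_eq_zero x hl]
  · linarith [norm_sub_le (σ.summand x j) A, σ.norm_summand_le hn hf x hK j]

end Sampling

/-! ### The smallest eigenvalue and its perturbation. -/

lemma bddBelow_eigenvalues (A : E d →L[ℝ] E d) :
    BddBelow {r : ℝ | Module.End.HasEigenvalue (A : E d →ₗ[ℝ] E d) r} := by
  refine ⟨-‖A‖, fun r hr => ?_⟩
  obtain ⟨v, hv⟩ := hr.exists_hasEigenvector
  have h1 : A v = r • v := hv.apply_eq_smul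
  have h2 : 0 < ‖v‖ := norm_pos_iff.2 hv.2
  have h3 := A.le_opNorm v
  rw [h1, norm_smul, Real.norm_eq_abs] at h3
  linarith [neg_abs_le r, le_of_mul_le_mul_right h3 h2]

lemma lamMin_le_inner {A : E d →L[ℝ] E d} (hA : IsSymm A) (v : E d) :
    lamMin A * ‖v‖ ^ 2 ≤ inner ℝ v (A v) := by
  obtain ⟨u, m, hu, -⟩ := exists_eigenbasis hA
  have hm : ∀ b, lamMin A ≤ m b := fun b =>
    csInf_le (bddBelow_eigenvalues A) (Module.End.hasEigenvalue_of_hasEigenvector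
      (x := u b) ⟨Module.End.mem_eigenspace_iff.2 (hu b), u.orthonormal.ne_zero b⟩)
  rw [← sum_eigen_mul_inner_sq hA u hu v, ← sum_inner_sq_right u v, Finset.mul_sum]
  exact Finset.sum_le_sum fun b _ => mul_le_mul_of_nonneg_right (hm b) (sq_nonneg _)

/-- Positive dimension supplies an eigenvalue; otherwise `sInf` would take its default value `0`. -/
lemma le_lamMin {A : E d →L[ℝ] E d} (hA : IsSymm A) (hd : 0 < d) {c : ℝ}
    (h : ∀ v, c * ‖v‖ ^ 2 ≤ inner ℝ v (A v)) : c ≤ lamMin A := by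
  obtain ⟨u, m, hu, -⟩ := exists_eigenbasis hA
  refine le_csInf ⟨m ⟨0, hd⟩, Module.End.hasEigenvalue_of_hasEigenvector (x := u ⟨0, hd⟩)
    ⟨Module.End.mem_eigenspace_iff.2 (hu _), u.orthonormal.ne_zero _⟩⟩ fun r hr => ?_
  obtain ⟨v, hv⟩ := hr.exists_hasEigenvector
  have h1 : A v = r • v := hv.apply_eq_smul
  have h2 : 0 < ‖v‖ ^ 2 := by have := norm_pos_iff.2 hv.2; positivity
  have h3 := h v
  rw [h1, real_inner_smul_right, real_inner_self_eq_norm_sq] at h3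
  exact le_of_mul_le_mul_right h3 h2

lemma inner_apply_sub_le (A H : E d →L[ℝ] E d) {ε : ℝ} (h : ‖H - A‖ ≤ ε) (v : E d) :
    |inner ℝ v (H v) - inner ℝ v (A v)| ≤ ε * ‖v‖ ^ 2 := by
  rw [← inner_sub_right, ← _root_.sub_apply]
  calc _ ≤ ‖v‖ * ‖(H - A) v‖ := abs_real_inner_le_norm _ _
    _ ≤ ‖v‖ * (ε * ‖v‖) := by
        gcongr
        exact (H - A).le_of_opNorm_le h v
    _ = _ := by ring

lemma lamMin_sub_le {A H : E d →L[ℝ] E d} (hA : IsSymm A) (hH : IsSymm H) (hd : 0 < d) {ε : ℝ}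
    (h : ‖H - A‖ ≤ ε) : lamMin H - ε ≤ lamMin A := by
  refine le_lamMin hA hd fun v => ?_
  have h1 := lamMin_le_inner hH v
  have h2 := (abs_le.1 (inner_apply_sub_le A H h v)).2
  linarith

/-! ### Deterministic analysis of the trust-region path. -/

/-- Second-order Taylor bound along a step. -/
lemma taylor_le {F : E d → ℝ} (hF : TwiceDifferentiable F) {L : ℝ} {x s : E d}
    (hL : HessLipschitzOnStep F L x s) :
    F (x + s) ≤ F x + inner ℝ (gradient F x) s + 1 / 2 * inner ℝ s (hess F x s) +
      L / 6 * ‖s‖ ^ 3 := by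
  set A := inner ℝ (gradient F x) s with hA
  set Q := inner ℝ s (hess F x s) with hQ
  set M := L * ‖s‖ ^ 3 with hM
  have hline : ∀ t : ℝ, HasDerivAt (fun t : ℝ => x + t • s) s t := fun t => by
    simpa using ((hasDerivAt_id t).smul_const s).const_add x
  have h1 : ∀ t : ℝ, HasDerivAt (fun t : ℝ => F (x + t • s))
      (inner ℝ (gradient F (x + t • s)) s) t := fun t => by
    have := (hasFDerivAt_gradient hF (x + t • s)).comp_hasDerivAt t (hline t)
    exact this
  have h2 : ∀ t : ℝ, HasDerivAt (fun t : ℝ => inner ℝ (gradient F (x + t • s)) s)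
      (inner ℝ (hess F (x + t • s) s) s) t := fun t => by
    have := ((hF.hasFDerivAt_hess (x + t • s)).comp_hasDerivAt t (hline t)).inner ℝ
      (hasDerivAt_const t s)
    simpa using this
  have h3 : ∀ t ∈ Set.Icc (0 : ℝ) 1, inner ℝ (hess F (x + t • s) s) s ≤ Q + M * t := fun t ht => by
    have hmem : x + t • s ∈ segment ℝ x (x + s) := by
      rw [segment_eq_image']
      exact ⟨t, ht, by simp⟩
    have h := hL _ hmem
    rw [add_sub_cancel_left, norm_smul, Real.norm_of_nonneg ht.1] at h
    have h' := (abs_le.1 (inner_apply_sub_le _ _ h s)).2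
    rw [real_inner_comm, hM]
    linarith
  -- Taylor's bound by monotonicity: `g'` decreases from `0` on `[0, 1]`, hence so does `g`. No
  -- integral is taken, so the Hessian need not be integrable along the segment.
  let g' : ℝ → ℝ := fun t => inner ℝ (gradient F (x + t • s)) s - (A + Q * t + M * t ^ 2 / 2)
  let g : ℝ → ℝ := fun t => F (x + t • s) - (A * t + Q * t ^ 2 / 2 + M * t ^ 3 / 6)
  have hg : ∀ t, HasDerivAt g (g' t) t := fun t => by
    have := (h1 t).sub ((((hasDerivAt_id t).const_mul A).add
      ((((hasDerivAt_id t).pow 2).const_mul Q).div_const 2)).add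
      ((((hasDerivAt_id t).pow 3).const_mul M).div_const 6))
    refine this.congr_deriv ?_
    simp [g']; ring
  have hg' : ∀ t, HasDerivAt g' (inner ℝ (hess F (x + t • s) s) s - (Q + M * t)) t := fun t => by
    have := (h2 t).sub (((hasDerivAt_const t A).add ((hasDerivAt_id t).const_mul Q)).add
      ((((hasDerivAt_id t).pow 2).const_mul M).div_const 2))
    refine this.congr_deriv ?_
    simp; ring
  have anti' : AntitoneOn g' (Set.Icc 0 1) := by
    refine antitoneOn_of_hasDerivWithinAt_nonpos (convex_Icc 0 1)
      (fun t _ => (hg' t).continuousAt.continuousWithinAt)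
      (fun t _ => (hg' t).hasDerivWithinAt) fun t ht => ?_
    linarith [h3 t (interior_subset ht)]
  have hg'0 : g' 0 = 0 := by simp [g', hA]
  have anti : AntitoneOn g (Set.Icc 0 1) := by
    refine antitoneOn_of_hasDerivWithinAt_nonpos (convex_Icc 0 1)
      (fun t _ => (hg t).continuousAt.continuousWithinAt)
      (fun t _ => (hg t).hasDerivWithinAt) fun t ht => ?_
    have ht' := interior_subset ht
    have := anti' (Set.left_mem_Icc.2 zero_le_one) ht' ht'.1
    rwa [hg'0] at this
  have := anti (Set.left_mem_Icc.2 zero_le_one) (Set.right_mem_Icc.2 zero_le_one) zero_le_one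
  simp only [g, zero_smul, one_smul, add_zero] at this
  rw [hM] at this
  linarith

lemma model_error_le {F : E d → ℝ} (hF : TwiceDifferentiable F) {L ε Δ : ℝ} (hL0 : 0 ≤ L)
    {x s : E d} {H : E d →L[ℝ] E d} (hL : HessLipschitzOnStep F L x s)
    (hH : ‖H - hess F x‖ ≤ ε) (hs : ‖s‖ ≤ Δ) :
    F (x + s) - F x - model F x H s ≤ ε / 2 * Δ ^ 2 + L / 6 * Δ ^ 3 := by
  have h1 := taylor_le hF hL
  have h2 := (abs_le.1 (inner_apply_sub_le _ _ hH s)).1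
  have hε : 0 ≤ ε := (norm_nonneg _).trans hH
  have h3 : ε / 2 * ‖s‖ ^ 2 ≤ ε / 2 * Δ ^ 2 := by gcongr
  have h4 : L / 6 * ‖s‖ ^ 3 ≤ L / 6 * Δ ^ 3 := by gcongr
  unfold model
  linarith

lemma le_rho_of_model_error {F : E d → ℝ} {η : ℝ} {x s : E d} {H : E d →L[ℝ] E d}
    (hm : 0 < -model F x H s)
    (h : F (x + s) - F x - model F x H s ≤ (1 - η) * -model F x H s) : η ≤ rho F x H s := by
  rw [rho, le_div_iff₀ hm]
  linarith

/-- Predicted decrease at a point where the stopping test fails. -/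
lemma predicted_decrease {F : E d → ℝ} {ν εg εH b Δ : ℝ} {x s : E d} {H : E d →L[ℝ] E d}
    (hν : 0 < ν) (hg : 0 < εg) (hH : 0 < εH) (hb : ‖H‖ ≤ b) (hΔ : 0 < Δ)
    (hgo : ¬ Stops F εg εH x H) (hdesc : SufficientDescent F ν x H Δ s) :
    1 / 2 * εg * min (εg / (1 + b)) Δ ≤ -model F x H s ∨
      1 / 2 * ν * εH * Δ ^ 2 ≤ -model F x H s := by
  rw [Stops, not_and_or, not_le, not_le] at hgo
  rcases hgo with h | h
  · left
    obtain ⟨⟨sC, -, h1, h2⟩, -⟩ := hdesc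
    refine le_trans ?_ (h2.trans h1)
    have : 0 ≤ ‖H‖ := norm_nonneg H
    have hmin : min (εg / (1 + b)) Δ ≤ min (‖gradient F x‖ / (1 + ‖H‖)) Δ := by
      refine min_le_min ?_ le_rfl
      gcongr
    have : 0 ≤ b := this.trans hb
    have : 0 ≤ min (εg / (1 + b)) Δ := le_min (by positivity) hΔ.le
    gcongr
  · right
    obtain ⟨-, hE⟩ := hdesc
    have hneg : lamMin H < 0 := by linarith
    obtain ⟨sE, -, -, h1, h2⟩ := hE hneg
    refine le_trans ?_ (h2.trans h1)
    have : εH ≤ |lamMin H| := by rw [abs_of_neg hneg]; linarith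
    gcongr

/-- Below `radiusThreshold * min εg εH` every radius gives a successful step. -/
noncomputable def radiusThreshold (η ν α L b : ℝ) : ℝ :=
  min (min (α * ((1 - η) * ν)) ((1 - α) * ((1 - η) * ν) / L))
    (min (1 / (1 + b)) ((1 - η) / (1 + L)))

lemma radiusThreshold_pos {η ν α L b : ℝ} (hη : η < 1) (hν : 0 < ν) (hα : 0 < α ∧ α < 1)
    (hL : 0 < L) (hb : 0 ≤ b) : 0 < radiusThreshold η ν α L b := by
  have h1 : 0 < 1 - η := by linarith
  have h2 : 0 < 1 - α := by linarith [hα.2]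
  have h3 := hα.1
  unfold radiusThreshold
  refine lt_min (lt_min ?_ ?_) (lt_min ?_ ?_) <;> positivity

lemma success_of_small_radius {F : E d → ℝ} (hF : TwiceDifferentiable F)
    {η ν α L b εg εH Δ : ℝ} {x s : E d} {H : E d →L[ℝ] E d}
    (hη : 0 < η ∧ η < 1) (hν : 0 < ν ∧ ν ≤ 1) (hα : 0 < α ∧ α < 1) (hL : 0 < L)
    (hg : 0 < εg ∧ εg < 1) (hH : 0 < εH ∧ εH < 1) (hb : ‖H‖ ≤ b) (hΔ : 0 < Δ)
    (hgo : ¬ Stops F εg εH x H) (hdesc : SufficientDescent F ν x H Δ s)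
    (hlip : HessLipschitzOnStep F L x s) (hs : ‖s‖ ≤ Δ)
    (hacc : ‖H - hess F x‖ ≤ max (α * (1 - η) * ν * εH) Δ)
    (hsmall : Δ ≤ radiusThreshold η ν α L b * min εg εH) : η ≤ rho F x H s := by
  have hb0 : 0 ≤ b := (norm_nonneg H).trans hb
  have h1η : 0 < 1 - η := by linarith [hη.2]
  have h1α : 0 < 1 - α := by linarith [hα.2]
  have hα0 := hα.1
  have hν0 := hν.1
  have hq : 0 < min εg εH := lt_min hg.1 hH.1
  have hk0 := radiusThreshold_pos (b := b) hη.2 hν.1 hα hL hb0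
  set k := radiusThreshold η ν α L b with hk
  -- `k1` makes the tolerance collapse to `ε₀`; `k2` leaves the share `1 - α` of the curvature
  -- decrease for the cubic error; `k3` makes `Δ` the minimum in the Cauchy condition; `k4` beats
  -- the model error in the gradient case.
  have k1 : k ≤ α * ((1 - η) * ν) := (min_le_left _ _).trans (min_le_left _ _)
  have k2 : k ≤ (1 - α) * ((1 - η) * ν) / L := (min_le_left _ _).trans (min_le_right _ _)
  have k3 : k ≤ 1 / (1 + b) := (min_le_right _ _).trans (min_le_left _ _)
  have k4 : k ≤ (1 - η) / (1 + L) := (min_le_right _ _).trans (min_le_right _ _)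
  rw [le_div_iff₀ hL] at k2
  rw [le_div_iff₀ (by positivity)] at k4
  have hω : (1 - η) * ν ≤ 1 := by nlinarith [hν.2, hη.1]
  have hΔg : Δ ≤ k * εg := hsmall.trans (mul_le_mul_of_nonneg_left (min_le_left _ _) hk0.le)
  have hΔH : Δ ≤ k * εH := hsmall.trans (mul_le_mul_of_nonneg_left (min_le_right _ _) hk0.le)
  have hk1 : k ≤ 1 := by nlinarith [hα.2]
  have hΔ1 : Δ ≤ 1 := hΔH.trans (by nlinarith [hH.2, hH.1])
  have herr := model_error_le hF hL.le hlip hacc hs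
  set ε := max (α * (1 - η) * ν * εH) Δ with hε
  have hΔle : Δ ≤ α * (1 - η) * ν * εH := by
    calc Δ ≤ k * εH := hΔH
      _ ≤ α * ((1 - η) * ν) * εH := mul_le_mul_of_nonneg_right k1 hH.1.le
      _ = _ := by ring
  have hεeq : ε = α * (1 - η) * ν * εH := max_eq_left hΔle
  rcases predicted_decrease hν.1 hg.1 hH.1 hb hΔ hgo hdesc with h | h
  · have hmin : min (εg / (1 + b)) Δ = Δ := by
      refine min_eq_right (hΔg.trans ?_)
      calc k * εg ≤ 1 / (1 + b) * εg := mul_le_mul_of_nonneg_right k3 hg.1.le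
        _ = _ := by ring
    rw [hmin] at h
    have hε1 : ε ≤ 1 := by
      rw [hεeq]
      have : α * ((1 - η) * ν) ≤ 1 := by nlinarith [hα.2, mul_pos h1η hν0]
      calc α * (1 - η) * ν * εH = α * ((1 - η) * ν) * εH := by ring
        _ ≤ 1 * 1 := mul_le_mul this hH.2.le hH.1.le zero_le_one
        _ = 1 := one_mul 1
    refine le_rho_of_model_error (lt_of_lt_of_le (by have := hg.1; positivity) h) (herr.trans ?_)
    refine le_trans ?_ (mul_le_mul_of_nonneg_left h h1η.le)
    have e1 : (1 + L) * Δ ≤ (1 - η) * εg := by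
      calc (1 + L) * Δ ≤ (1 + L) * (k * εg) := by gcongr
        _ = k * (1 + L) * εg := by ring
        _ ≤ _ := mul_le_mul_of_nonneg_right k4 hg.1.le
    have e2 : ε * Δ ^ 2 ≤ 1 * Δ ^ 2 := by gcongr
    have e3 : L * Δ ^ 3 ≤ L * Δ ^ 2 := by
      have : Δ ^ 3 ≤ Δ ^ 2 := pow_le_pow_of_le_one hΔ.le hΔ1 (by norm_num)
      gcongr
    have e4 := mul_le_mul_of_nonneg_right e1 hΔ.le
    have e5 : 0 ≤ L * Δ ^ 2 := by positivity
    nlinarith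
  · refine le_rho_of_model_error (lt_of_lt_of_le (by have := hH.1; positivity) h) (herr.trans ?_)
    refine le_trans ?_ (mul_le_mul_of_nonneg_left h h1η.le)
    have e1 : ε + L * Δ ≤ (1 - η) * ν * εH := by
      have : L * Δ ≤ (1 - α) * ((1 - η) * ν) * εH := by
        calc L * Δ ≤ L * (k * εH) := by gcongr
          _ = k * L * εH := by ring
          _ ≤ _ := mul_le_mul_of_nonneg_right k2 hH.1.le
      rw [hεeq]; linarith
    have e2 := mul_le_mul_of_nonneg_right e1 (sq_nonneg Δ)
    have e5 : 0 ≤ L * Δ ^ 3 := by positivity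
    nlinarith

/-- The radii of a run with accurate Hessians stay above `radiusFloor * min εg εH`. -/
noncomputable def radiusFloor (η γ ν α Δ₀ L b : ℝ) : ℝ := min Δ₀ (radiusThreshold η ν α L b / γ)

/-- A successful step predicts a decrease of at least `decreaseFloor * εH * (min εg εH) ^ 2`. -/
noncomputable def decreaseFloor (η γ ν α Δ₀ L b : ℝ) : ℝ :=
  1 / 2 * min (min (1 / (1 + b)) (radiusFloor η γ ν α Δ₀ L b))
    (ν * radiusFloor η γ ν α Δ₀ L b ^ 2)

/-- The constant in the bound on the number of steps. -/
noncomputable def stepConstant (η γ ν α Δ₀ L b D : ℝ) : ℝ :=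
  2 * D / (η * decreaseFloor η γ ν α Δ₀ L b) + Δ₀ / (radiusFloor η γ ν α Δ₀ L b * Real.log γ)

lemma radiusFloor_pos {η γ ν α Δ₀ L b : ℝ} (hη : η < 1) (hγ : 1 < γ) (hν : 0 < ν)
    (hα : 0 < α ∧ α < 1) (hΔ₀ : 0 < Δ₀) (hL : 0 < L) (hb : 0 ≤ b) :
    0 < radiusFloor η γ ν α Δ₀ L b :=
  lt_min hΔ₀ (div_pos (radiusThreshold_pos hη hν hα hL hb) (by linarith))

lemma decreaseFloor_pos {η γ ν α Δ₀ L b : ℝ} (hη : η < 1) (hγ : 1 < γ) (hν : 0 < ν)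
    (hα : 0 < α ∧ α < 1) (hΔ₀ : 0 < Δ₀) (hL : 0 < L) (hb : 0 ≤ b) :
    0 < decreaseFloor η γ ν α Δ₀ L b := by
  have := radiusFloor_pos hη hγ hν hα hΔ₀ hL hb
  unfold decreaseFloor
  refine mul_pos (by norm_num) (lt_min (lt_min ?_ this) ?_) <;> positivity

lemma stepConstant_nonneg {η γ ν α Δ₀ L b D : ℝ} (hη : 0 < η ∧ η < 1) (hγ : 1 < γ) (hν : 0 < ν)
    (hα : 0 < α ∧ α < 1) (hΔ₀ : 0 < Δ₀) (hL : 0 < L) (hb : 0 ≤ b) (hD : 0 ≤ D) :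
    0 ≤ stepConstant η γ ν α Δ₀ L b D := by
  have h1 := radiusFloor_pos hη.2 hγ hν hα hΔ₀ hL hb
  have h2 := decreaseFloor_pos hη.2 hγ hν hα hΔ₀ hL hb
  have h3 := Real.log_pos hγ
  have h4 := hη.1
  unfold stepConstant
  positivity

lemma predicted_decrease_of_radius {F : E d → ℝ} {η γ ν α Δ₀ L εg εH b Δ : ℝ} {x s : E d}
    {H : E d →L[ℝ] E d} (hη : η < 1) (hγ : 1 < γ) (hν : 0 < ν) (hα : 0 < α ∧ α < 1)
    (hΔ₀ : 0 < Δ₀) (hL : 0 < L) (hg : 0 < εg) (hH : 0 < εH ∧ εH < 1) (hb : ‖H‖ ≤ b)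
    (hgo : ¬ Stops F εg εH x H) (hdesc : SufficientDescent F ν x H Δ s)
    (hΔ : radiusFloor η γ ν α Δ₀ L b * min εg εH ≤ Δ) :
    decreaseFloor η γ ν α Δ₀ L b * (εH * min εg εH ^ 2) ≤ -model F x H s := by
  have hb0 : 0 ≤ b := (norm_nonneg H).trans hb
  have hr := radiusFloor_pos hη hγ hν hα hΔ₀ hL hb0
  have hH0 := hH.1
  unfold decreaseFloor
  set r := radiusFloor η γ ν α Δ₀ L b with hrdef
  set q := min εg εH with hq
  have hq0 : 0 < q := lt_min hg hH.1
  have hqg : q ≤ εg := min_le_left _ _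
  have hΔ0 : 0 < Δ := lt_of_lt_of_le (by positivity) hΔ
  rcases predicted_decrease hν hg hH.1 hb hΔ0 hgo hdesc with h | h
  · refine le_trans ?_ h
    have hmin : q * min (1 / (1 + b)) r ≤ min (εg / (1 + b)) Δ := by
      refine le_min ?_ ?_
      · calc q * min (1 / (1 + b)) r ≤ εg * (1 / (1 + b)) := by
              have : 0 ≤ min (1 / (1 + b)) r := le_min (by positivity) hr.le
              gcongr
              exact min_le_left _ _
          _ = _ := by ring
      · calc q * min (1 / (1 + b)) r ≤ q * r := by gcongr; exact min_le_right _ _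
          _ = r * q := mul_comm _ _
          _ ≤ Δ := hΔ
    have hm0 : 0 < min (1 / (1 + b)) r := lt_min (by positivity) hr
    calc _ ≤ 1 / 2 * min (1 / (1 + b)) r * (1 * q ^ 2) :=
          mul_le_mul (mul_le_mul_of_nonneg_left (min_le_left _ _) (by norm_num))
            (mul_le_mul_of_nonneg_right hH.2.le (sq_nonneg q)) (by positivity) (by positivity)
      _ = 1 / 2 * q * (q * min (1 / (1 + b)) r) := by ring
      _ ≤ _ := by gcongr
  · refine le_trans ?_ h
    calc _ ≤ 1 / 2 * (ν * r ^ 2) * (εH * q ^ 2) := by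
          gcongr
          exact min_le_right _ _
      _ = 1 / 2 * ν * εH * (r * q) ^ 2 := by ring
      _ ≤ _ := by gcongr

/-- Bound on the number of steps of a run in which all the approximate Hessians are accurate. -/
lemma steps_le {F : E d → ℝ} (hF : TwiceDifferentiable F) {η γ ν α Δ₀ L b D εg εH : ℝ}
    (hη : 0 < η ∧ η < 1) (hγ : 1 < γ) (hν : 0 < ν ∧ ν ≤ 1) (hα : 0 < α ∧ α < 1) (hΔ₀ : 0 < Δ₀)
    (hL : 0 < L) (hg : 0 < εg ∧ εg < 1) (hH : 0 < εH ∧ εH < 1) {x₀ : E d}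
    (hD : ∀ y, F x₀ - F y ≤ D) {x s : ℕ → E d} {Δ : ℕ → ℝ} {H : ℕ → E d →L[ℝ] E d}
    (hb : ∀ t, ‖H t‖ ≤ b) (hpath : IsTrustRegionPath F η γ Δ₀ εg εH x₀ x s Δ H)
    (hdesc : ∀ t, Active F εg εH x H t → SufficientDescent F ν (x t) (H t) (Δ t) (s t))
    (hlip : ∀ t, Active F εg εH x H t → HessLipschitzOnStep F L (x t) (s t)) {N : ℕ}
    (hacc : ∀ t < N, ‖H t - hess F (x t)‖ ≤ max (α * (1 - η) * ν * εH) (Δ t))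
    (hact : ∀ t < N, Active F εg εH x H t) :
    (N : ℝ) ≤ stepConstant η γ ν α Δ₀ L b D / (εH * min εg εH ^ 2) := by
  have hb0 : 0 ≤ b := (norm_nonneg _).trans (hb 0)
  have hr := radiusFloor_pos hη.2 hγ hν.1 hα hΔ₀ hL hb0
  have hw := decreaseFloor_pos hη.2 hγ hν.1 hα hΔ₀ hL hb0
  have hη0 := hη.1
  have hH0 := hH.1
  have hγ0 : 0 < γ := by linarith
  have hlog : 0 < Real.log γ := Real.log_pos hγ
  unfold stepConstant
  set r := radiusFloor η γ ν α Δ₀ L b with hrdef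
  set w := decreaseFloor η γ ν α Δ₀ L b with hwdef
  set q := min εg εH with hq
  have hq0 : 0 < q := lt_min hg.1 hH.1
  have hq1 : q ≤ 1 := (min_le_left _ _).trans hg.2.le
  have hq3 : 0 < εH * q ^ 2 := by positivity
  have hq3q : εH * q ^ 2 ≤ q := by
    have : q ^ 2 ≤ q := by nlinarith
    nlinarith [hH.2, sq_nonneg q]
  set c := η * w * (εH * q ^ 2) with hc
  have hc0 : 0 < c := by positivity
  -- A potential that grows by at least one per step: a success contributes at least `2` through `F`
  -- and `-1` through `log Δ`, a failure contributes `+1` through `log Δ`.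
  have key : ∀ t ≤ N, r * q ≤ Δ t ∧ (t : ℝ) ≤ 2 / c * (F x₀ - F (x t)) +
      (Real.log Δ₀ - Real.log (Δ t)) / Real.log γ := by
    intro t
    induction t with
    | zero =>
      intro _
      rw [hpath.init_point, hpath.init_radius]
      refine ⟨?_, by simp⟩
      calc r * q ≤ r * 1 := by gcongr
        _ = r := mul_one r
        _ ≤ Δ₀ := min_le_left _ _
    | succ t ih =>
      intro ht
      obtain ⟨ihΔ, ihV⟩ := ih (by omega)
      have hA := hact t (by omega)
      have hΔpos : 0 < Δ t := lt_of_lt_of_le (by positivity) ihΔ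
      by_cases hρ : η ≤ rho F (x t) (H t) (s t)
      · obtain ⟨e1, e2⟩ := hpath.success t hA hρ
        rw [e1, e2]
        refine ⟨ihΔ.trans (le_mul_of_one_le_left hΔpos.le hγ.le), ?_⟩
        have hp := predicted_decrease_of_radius hη.2 hγ hν.1 hα hΔ₀ hL hg.1 hH (hb t) hA.2
          (hdesc t hA) ihΔ
        have hm : 0 < -model F (x t) (H t) (s t) := lt_of_lt_of_le (by positivity) hp
        rw [rho, le_div_iff₀ hm] at hρ
        have hdec : c ≤ F (x t) - F (x t + s t) :=
          le_trans (by rw [hc, mul_assoc]; exact mul_le_mul_of_nonneg_left hp hη0.le) hρ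
        have h2 : 2 ≤ 2 / c * (F (x t) - F (x t + s t)) := by
          calc (2 : ℝ) = 2 / c * c := by field_simp
            _ ≤ _ := by gcongr
        rw [Real.log_mul hγ0.ne' hΔpos.ne', show Real.log Δ₀ - (Real.log γ + Real.log (Δ t)) =
          Real.log Δ₀ - Real.log (Δ t) - Real.log γ by ring, sub_div, div_self hlog.ne']
        push_cast
        linarith
      · have hρ' := not_le.1 hρ
        obtain ⟨e1, e2⟩ := hpath.failure t hA hρ'
        rw [e1, e2]
        constructor
        -- A failure excludes radii below the threshold, so a single division by `γ` cannot cross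
        -- the floor.
        · have hbig : radiusThreshold η ν α L b * q < Δ t := by
            by_contra hcon
            exact hρ (success_of_small_radius hF hη hν hα hL hg hH (hb t) hΔpos hA.2 (hdesc t hA)
              (hlip t hA) (hpath.feasible t hA) (hacc t (by omega)) (not_lt.1 hcon))
          rw [le_div_iff₀ hγ0]
          calc r * q * γ ≤ radiusThreshold η ν α L b / γ * q * γ := by
                gcongr; exact min_le_right _ _
            _ = radiusThreshold η ν α L b * q := by field_simp
            _ ≤ _ := hbig.le
        · rw [Real.log_div hΔpos.ne' hγ0.ne', show Real.log Δ₀ - (Real.log (Δ t) - Real.log γ) =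
            Real.log Δ₀ - Real.log (Δ t) + Real.log γ by ring, add_div, div_self hlog.ne']
          push_cast
          linarith
  obtain ⟨h1, h2⟩ := key N le_rfl
  have hrq : 0 < r * q := by positivity
  -- The crude `log y ≤ y` suffices, as `1 / q` is already dominated by `1 / (εH q²)`.
  have h3 : Real.log Δ₀ - Real.log (Δ N) ≤ Δ₀ / (r * (εH * q ^ 2)) := by
    calc _ ≤ Real.log Δ₀ - Real.log (r * q) := by
          linarith [Real.log_le_log hrq h1]
      _ = Real.log (Δ₀ / (r * q)) := (Real.log_div hΔ₀.ne' hrq.ne').symm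
      _ ≤ Δ₀ / (r * q) := Real.log_le_self (by positivity)
      _ ≤ _ := by gcongr
  calc (N : ℝ) ≤ 2 / c * D + Δ₀ / (r * (εH * q ^ 2)) / Real.log γ := by
        refine h2.trans (add_le_add ?_ ?_)
        · exact mul_le_mul_of_nonneg_left (hD _) (by positivity)
        · gcongr
    _ = _ := by rw [hc]; field_simp

lemma exists_stop {F : E d → ℝ} {εg εH : ℝ} {x : ℕ → E d} {H : ℕ → E d →L[ℝ] E d} {N : ℕ}
    (h : ¬ ∀ t < N, Active F εg εH x H t) :
    ∃ T < N, Reached F εg εH x H T ∧ Stops F εg εH (x T) (H T) := by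
  classical
  have hex : ∃ t, t < N ∧ Stops F εg εH (x t) (H t) := by
    by_contra! hcon
    exact h fun t ht => ⟨fun k hk => hcon k (hk.trans ht), hcon t ht⟩
  refine ⟨Nat.find hex, (Nat.find_spec hex).1, fun k hk hs => ?_, (Nat.find_spec hex).2⟩
  exact Nat.find_min hex hk ⟨hk.trans (Nat.find_spec hex).1, hs⟩

/-! ### Conditional sampling and measurability. -/

open scoped ENNReal

open Classical in
/-- If, on the event `R`, a countably valued variable `S` is conditionally bad with probability at
most `p`, then the probability that `R` holds and `S` is bad is at most `p`. -/
lemma measure_bad_le {Ω ι : Type*} [Countable ι] {m mΩ : MeasurableSpace Ω} (hm : m ≤ mΩ)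
    {μ : Measure Ω} [IsProbabilityMeasure μ] {S : Ω → ι} (hS : ∀ l, MeasurableSet {ω | S ω = l})
    {R : Set Ω} (hR : MeasurableSet[m] R) {B : ι → Set Ω} (hB : ∀ l, MeasurableSet[m] (B l))
    {p : ℝ≥0∞}
    (h : ∀ ω ∈ R, ∑' l, (if ω ∈ B l then ENNReal.ofReal
      ((μ[Set.indicator {ω' | S ω' = l} (fun _ => (1 : ℝ)) | m]) ω) else 0) ≤ p) :
    μ {ω | ω ∈ R ∧ ω ∈ B (S ω)} ≤ p := by
  set g : ι → Ω → ℝ := fun l => μ[Set.indicator {ω' | S ω' = l} (fun _ => (1 : ℝ)) | m] with hg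
  have hint : ∀ l, Integrable (Set.indicator {ω' | S ω' = l} (fun _ => (1 : ℝ))) μ :=
    fun l => (integrable_const 1).indicator (hS l)
  have hg0 : ∀ l, 0 ≤ᵐ[μ] g l := fun l =>
    condExp_nonneg (Filter.Eventually.of_forall fun ω => Set.indicator_nonneg (by simp) ω)
  have hgm : ∀ l, Measurable (g l) := fun l =>
    (stronglyMeasurable_condExp.mono hm).measurable
  -- `R ∩ B l` is known before the draw, so on it the conditional probability integrates to the
  -- probability.
  have hmeas : ∀ l, μ (R ∩ B l ∩ {ω | S ω = l}) =
      ∫⁻ ω in R, (if ω ∈ B l then ENNReal.ofReal (g l ω) else 0) ∂μ := fun l => by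
    have hRB : MeasurableSet[m] (R ∩ B l) := hR.inter (hB l)
    have e1 : ∫ ω in R ∩ B l, g l ω ∂μ = μ.real (R ∩ B l ∩ {ω | S ω = l}) := by
      rw [hg, setIntegral_condExp hm (hint l) hRB, integral_indicator (hS l),
        setIntegral_const, smul_eq_mul, mul_one, measureReal_restrict_apply (hS l), Set.inter_comm]
    have e2 : μ (R ∩ B l ∩ {ω | S ω = l}) = ENNReal.ofReal (∫ ω in R ∩ B l, g l ω ∂μ) := by
      rw [e1, Measure.real, ENNReal.ofReal_toReal (measure_ne_top _ _)]
    rw [e2, ofReal_integral_eq_lintegral_ofReal integrable_condExp.integrableOn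
      (ae_restrict_of_ae (hg0 l)), Set.inter_comm, ← Measure.restrict_restrict (hm _ (hB l)),
      ← lintegral_indicator (hm _ (hB l))]
    rfl
  calc μ {ω | ω ∈ R ∧ ω ∈ B (S ω)} ≤ μ (⋃ l, R ∩ B l ∩ {ω | S ω = l}) := by
        refine measure_mono fun ω hω => Set.mem_iUnion.2 ⟨S ω, ⟨hω.1, hω.2⟩, rfl⟩
    _ ≤ ∑' l, μ (R ∩ B l ∩ {ω | S ω = l}) := measure_iUnion_le _
    _ = ∫⁻ ω in R, ∑' l, (if ω ∈ B l then ENNReal.ofReal (g l ω) else 0) ∂μ := by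
        simp_rw [hmeas]
        rw [lintegral_tsum]
        exact fun l => (Measurable.ite (hm _ (hB l)) (hgm l).ennreal_ofReal
          measurable_const).aemeasurable
    _ ≤ ∫⁻ _ in R, p ∂μ := setLIntegral_mono measurable_const h
    _ ≤ p := by
        rw [setLIntegral_const]
        exact mul_le_of_le_one_right' prob_le_one

instance : SecondCountableTopology (E d →L[ℝ] E d) :=
  have : ProperSpace (E d →L[ℝ] E d) := FiniteDimensional.proper ℝ _
  inferInstance

lemma measurable_hess (f : E d → ℝ) : Measurable (hess f) := measurable_fderiv ℝ (gradient f)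

lemma measurable_weight {n : ℕ} (φ : Fin n → ℝ → ℝ) (a : Fin n → E d) (i : Fin n) :
    Measurable fun x => weight φ a x i := by
  unfold weight
  have h : Measurable fun x : E d => inner ℝ (a i) x := by fun_prop
  have h2 : Measurable fun x : E d => |deriv (deriv (φ i)) (inner ℝ (a i) x)| :=
    continuous_abs.measurable.comp ((measurable_deriv _).comp h)
  exact h2.mul_const _

lemma measurable_list_sum {α ι V : Type*} [MeasurableSpace α] [AddCommMonoid V]
    [MeasurableSpace V] [MeasurableAdd₂ V] (l : List ι) {g : ι → α → V}
    (hg : ∀ i, Measurable (g i)) : Measurable fun x => (l.map fun i => g i x).sum := by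
  induction l with
  | nil => simp
  | cons j l ih =>
    simp only [List.map_cons, List.sum_cons]
    exact (hg j).add ih

lemma measurable_list_prod {α ι : Type*} [MeasurableSpace α] (l : List ι) {g : ι → α → ℝ}
    (hg : ∀ i, Measurable (g i)) : Measurable fun x => (l.map fun i => g i x).prod := by
  induction l with
  | nil => simp
  | cons j l ih =>
    simp only [List.map_cons, List.prod_cons]
    exact (hg j).mul ih

namespace Sampling

variable {n : ℕ} {f : Fin n → E d → ℝ}

lemma measurable_prob (σ : Sampling f) (j : Fin n) : Measurable fun x => σ.prob x j := by
  cases σ with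
  | uniformWithReplacement => exact measurable_const
  | uniformWithoutReplacement => exact measurable_const
  | nonuniform φ a =>
    simp only [prob, nonuniformProb]
    have h : Measurable fun x => ∑ j, weight φ a x j :=
      Finset.measurable_sum _ fun i _ => measurable_weight φ a i
    exact Measurable.ite (h (measurableSet_singleton 0)) measurable_const
      ((measurable_weight φ a j).div h)

lemma measurable_law (σ : Sampling f) (s : ℕ) (l : List (Fin n)) :
    Measurable fun x => σ.law x s l := by
  cases σ with
  | uniformWithReplacement => exact measurable_const
  | uniformWithoutReplacement => exact measurable_const
  | nonuniform φ a =>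
    simp only [law, lawWithReplacement]
    split_ifs
    · exact measurable_list_prod l fun i => measurable_prob (nonuniform φ a) i
    · exact measurable_const

lemma measurable_subHess (σ : Sampling f) (l : List (Fin n)) :
    Measurable fun x => subHess f (σ.prob x) l x := by
  unfold subHess
  have h := measurable_list_sum (V := E d →L[ℝ] E d) l
    (g := fun j x => (1 / σ.prob x j) • hess (f j) x)
    fun j => (measurable_const.div (σ.measurable_prob j)).smul (measurable_hess _)
  exact h.const_smul (1 / ((n : ℝ) * (l.length : ℝ)))

lemma measurable_requiredSize (σ : Sampling f) (K : Fin n → ℝ) (δ₀ : ℝ) :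
    Measurable fun ε => σ.requiredSize K ε δ₀ := by
  cases σ <;> simp only [requiredSize] <;>
    exact (measurable_const.div (measurable_id.pow_const 2)).mul_const _

end Sampling

/-! ### Adding up the failure probabilities. -/

lemma min_sq_mul_eq {a b : ℝ} (ha : 0 < a) (hb : 0 < b) :
    b * min a b ^ 2 = min (a ^ 2 * b) (b ^ 3) := by
  rcases le_total a b with h | h
  · have : a ^ 2 ≤ b ^ 2 := by gcongr
    rw [min_eq_left h, min_eq_left (by nlinarith)]; ring
  · have : b ^ 2 ≤ a ^ 2 := by gcongr
    rw [min_eq_right h, min_eq_right (by nlinarith)]; ring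

lemma max_one_div {a b : ℝ} (ha : 0 < a) (hb : 0 < b) :
    max (1 / a) (1 / b) = 1 / min a b := by
  rcases le_total a b with h | h
  · rw [min_eq_left h, max_eq_left (one_div_le_one_div_of_le ha h)]
  · rw [min_eq_right h, max_eq_right (one_div_le_one_div_of_le hb h)]

/-- Over at most `C / q` iterations the failure probabilities add up to at most `δ`. -/
lemma sum_failure_le {C q δ : ℝ} (hC : 0 < C) (hq : 0 < q) (hδ : 0 < δ) :
    C / q * min (1 / C ^ 3) (δ * q) ^ (4 / 3 : ℝ) ≤ δ := by
  set p := min (1 / C ^ 3) (δ * q) with hp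
  have hp0 : 0 < p := lt_min (by positivity) (by positivity)
  -- The surplus exponent `1/3` turns `p ≤ C⁻³` into the factor `1 / C` that cancels the constant in
  -- the iteration count.
  have h1 : p ^ (1 / 3 : ℝ) ≤ 1 / C := by
    calc p ^ (1 / 3 : ℝ) ≤ ((1 / C) ^ (3 : ℕ)) ^ (1 / 3 : ℝ) := by
          refine Real.rpow_le_rpow hp0.le ?_ (by norm_num)
          rw [one_div_pow]; exact min_le_left _ _
      _ = 1 / C := by
          rw [← Real.rpow_natCast, ← Real.rpow_mul (by positivity)]; norm_num
  have h2 : p ^ (4 / 3 : ℝ) = p * p ^ (1 / 3 : ℝ) := by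
    rw [show (4 / 3 : ℝ) = 1 + 1 / 3 by norm_num, Real.rpow_add hp0, Real.rpow_one]
  calc C / q * p ^ (4 / 3 : ℝ) ≤ C / q * (δ * q * (1 / C)) := by
        rw [h2]
        gcongr
        exact min_le_right _ _
    _ = δ := by field_simp

variable {n : ℕ} {f : Fin n → E d → ℝ}

/-- Among the iterations that are reached, an inaccurate Hessian occurs at iteration `t` only
within an event of probability at most `δ₀ ^ (4 / 3)`. -/
lemma IsSubsampledRun.exists_bad {σ : Sampling f} {K : Fin n → ℝ}
    {L η γ ν Δ₀ ε₀ εg εH δ₀ : ℝ} {x₀ : E d} {Ω : Type u} [mΩ : MeasurableSpace Ω]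
    {μ : Measure Ω} [IsProbabilityMeasure μ] {ℱ : Filtration ℕ mΩ} {x s : ℕ → Ω → E d}
    {Δ ε : ℕ → Ω → ℝ} {m : ℕ → Ω → ℕ} {S : ℕ → Ω → List (Fin n)}
    (h : IsSubsampledRun σ K L η γ ν Δ₀ ε₀ εg εH δ₀ x₀ μ ℱ x s Δ ε m S) (hn : 0 < n)
    (hd : 0 < d) (hf : ∀ i, TwiceDifferentiable (f i)) (hK : ∀ i x, ‖hess (f i) x‖ ≤ K i)
    (hδ : 0 < δ₀) (hδ1 : δ₀ < 1) (t : ℕ) :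
    ∃ bad : Set Ω, μ bad ≤ ENNReal.ofReal (δ₀ ^ (4 / 3 : ℝ)) ∧ ∀ᵐ ω ∂μ, ω ∉ bad →
      Reached (finiteSum f) εg εH (x · ω) (pathHess σ (x · ω) (S · ω)) t →
      ‖pathHess σ (x · ω) (S · ω) t - hess (finiteSum f) (x t ω)‖ ≤ ε t ω := by
  let g : List (Fin n) → Ω → ℝ := fun l =>
    μ[Set.indicator {ω' | S t ω' = l} (fun _ => (1 : ℝ)) | ℱ t]
  -- Reaching iteration `t` enters only through these consequences, almost sure on that event and
  -- visibly `ℱ t`-measurable. Lists are countable, so the identities for the law hold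
  -- simultaneously.
  let R : Set Ω := {ω | (∀ l, g l ω = σ.law (x t ω) (m t ω) l) ∧ 0 < ε t ω ∧ 0 < m t ω ∧
    σ.requiredSize K (ε t ω) δ₀ ≤ m t ω}
  let B : List (Fin n) → Set Ω := fun l =>
    {ω | ε t ω < ‖subHess f (σ.prob (x t ω)) l (x t ω) - hess (finiteSum f) (x t ω)‖}
  have hx := h.measurable_x t
  have hε := h.measurable_tolerance t
  have hm := h.measurable_size t
  have hlaw : ∀ l, Measurable[ℱ t] fun ω => σ.law (x t ω) (m t ω) l := fun l => by
    have : Measurable fun p : ℕ × E d => σ.law p.2 p.1 l :=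
      measurable_from_prod_countable_right fun s => σ.measurable_law s l
    exact this.comp (hm.prodMk hx)
  have hR : MeasurableSet[ℱ t] R := by
    refine MeasurableSet.inter ?_ (MeasurableSet.inter ?_ (MeasurableSet.inter ?_ ?_))
    · have : {ω | ∀ l, g l ω = σ.law (x t ω) (m t ω) l} =
          ⋂ l, {ω | g l ω = σ.law (x t ω) (m t ω) l} := by ext; simp
      change MeasurableSet[ℱ t] {ω | ∀ l, g l ω = σ.law (x t ω) (m t ω) l}
      rw [this]
      exact MeasurableSet.iInter fun l =>
        measurableSet_eq_fun stronglyMeasurable_condExp.measurable (hlaw l)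
    · exact measurableSet_lt measurable_const hε
    · exact measurableSet_lt measurable_const hm
    · exact measurableSet_le ((σ.measurable_requiredSize K δ₀).comp hε)
        ((measurable_from_top (f := fun k : ℕ => (k : ℝ))).comp hm)
  have hB : ∀ l, MeasurableSet[ℱ t] (B l) := fun l =>
    measurableSet_lt hε
      (((σ.measurable_subHess l).sub (measurable_hess (finiteSum f))).norm.comp hx)
  refine ⟨{ω | ω ∈ R ∧ ω ∈ B (S t ω)}, ?_, ?_⟩
  · refine measure_bad_le (ℱ.le t) (fun l => ℱ.le (t + 1) _ (h.measurable_sample t l)) hR hB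
      fun ω hω => ?_
    obtain ⟨h1, h2, h3, h4⟩ := hω
    have h5 := σ.tsum_law_bad_le hn hd hf (x t ω) (fun i => hK i _) h2 hδ hδ1 h3 h4
    refine le_trans (le_of_eq (tsum_congr fun l => ?_)) h5
    have h6 : (μ[Set.indicator {ω' | S t ω' = l} (fun _ => (1 : ℝ)) | ℱ t]) ω =
      σ.law (x t ω) (m t ω) l := h1 l
    rw [h6]
    rfl
  · have hall := ae_all_iff.2 fun l => h.sample t l
    filter_upwards [hall, h.tolerance, h.size] with ω h1 h2 h3 hbad hreach
    by_contra hcon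
    exact hbad ⟨⟨fun l => h1 l hreach, (h2 t hreach).1, (h3 t hreach).1, (h3 t hreach).2⟩,
      not_le.1 hcon⟩

end SubsampledTR

/-! ### The main theorem. -/

open SubsampledTR in
theorem mainTheorem6
    (η γ ν α Δ₀ L B D : ℝ) (hη : 0 < η ∧ η < 1) (hγ : 1 < γ) (hν : 0 < ν ∧ ν ≤ 1)
    (hα : 0 < α ∧ α < 1) (hΔ₀ : 0 < Δ₀) (hL : 0 < L) :
    ∃ C c : ℝ, 0 < C ∧ 0 < c ∧
      ∀ (n d : ℕ) (f : Fin n → E d → ℝ) (σ : Sampling f) (K : Fin n → ℝ) (x₀ : E d)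
        (εg εH δ : ℝ),
        0 < n → 0 < d →
        (∀ i, TwiceDifferentiable (f i)) →
        (∀ i x, ‖hess (f i) x‖ ≤ K i) →
        σ.bound K ≤ B →
        (∀ y, finiteSum f x₀ - finiteSum f y ≤ D) →
        0 < εg → εg < 1 → 0 < εH → εH < 1 → 0 < δ → δ < 1 →
        ∀ (Ω : Type u) [mΩ : MeasurableSpace Ω] (μ : Measure Ω) [IsProbabilityMeasure μ]
          (ℱ : Filtration ℕ mΩ) (x s : ℕ → Ω → E d) (Δ ε : ℕ → Ω → ℝ) (m : ℕ → Ω → ℕ)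
          (S : ℕ → Ω → List (Fin n)),
          IsSubsampledRun σ K L η γ ν Δ₀ (α * (1 - η) * ν * εH) εg εH
            (min c (δ * min (εg ^ 2 * εH) (εH ^ 3))) x₀ μ ℱ x s Δ ε m S →
          ENNReal.ofReal (1 - δ) ≤
            μ {ω | ∃ T : ℕ, (T : ℝ) + 1 ≤ C * max (1 / (εg ^ 2 * εH)) (1 / εH ^ 3) ∧
              Reached (finiteSum f) εg εH (x · ω) (pathHess σ (x · ω) (S · ω)) T ∧
              Stops (finiteSum f) εg εH (x T ω) (pathHess σ (x · ω) (S · ω) T) ∧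
              ‖gradient (finiteSum f) (x T ω)‖ ≤ εg ∧
              -(ε T ω + εH) ≤ lamMin (hess (finiteSum f) (x T ω))} := by
  -- `B` and `D` are fixed before the problem and may be negative, hence the maxima. The extra `1`
  -- in `C₀ + 1` pays for rounding up the number of iterations, as `q < 1`.
  set C₀ := stepConstant η γ ν α Δ₀ L (max B 0) (max D 0) with hC₀
  have hC₀0 : 0 ≤ C₀ :=
    stepConstant_nonneg hη hγ hν.1 hα hΔ₀ hL (le_max_right _ _) (le_max_right _ _)
  have hC : 0 < C₀ + 1 := by linarith
  refine ⟨C₀ + 1, 1 / (C₀ + 1) ^ 3, hC, by positivity, ?_⟩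
  intro n d f σ K x₀ εg εH δ hn hd hf hK hB hD hg hg1 hH hH1 hδ hδ1 Ω mΩ μ _ ℱ x s Δ ε m S hrun
  set F := finiteSum f with hFdef
  have hF : TwiceDifferentiable F := twiceDifferentiable_finiteSum hf
  set q := min (εg ^ 2 * εH) (εH ^ 3) with hq
  have hq0 : 0 < q := lt_min (by positivity) (by positivity)
  have hq1 : q < 1 := (min_le_right _ _).trans_lt (pow_lt_one₀ hH.le hH1 (by norm_num))
  set δ₀ := min (1 / (C₀ + 1) ^ 3) (δ * q) with hδ₀
  have hδ₀0 : 0 < δ₀ := lt_min (by positivity) (by positivity)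
  have hδ₀1 : δ₀ < 1 := (min_le_right _ _).trans_lt (by nlinarith)
  choose bad hbad hgood using fun t => hrun.exists_bad hn hd hf hK hδ₀0 hδ₀1 t
  rw [max_one_div (by positivity) (by positivity), ← hq, mul_one_div]
  set N := ⌊C₀ / q⌋₊ + 1 with hN
  have hNlt : C₀ / q < N := by rw [hN]; push_cast; exact Nat.lt_floor_add_one _
  have hNle : (N : ℝ) ≤ (C₀ + 1) / q := by
    have h1 : (⌊C₀ / q⌋₊ : ℝ) ≤ C₀ / q := Nat.floor_le (by positivity)
    have h2 : 1 ≤ 1 / q := by rw [le_div_iff₀ hq0]; linarith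
    rw [hN, add_div]; push_cast; linarith
  set G := {ω | ∃ T : ℕ, (T : ℝ) + 1 ≤ (C₀ + 1) / q ∧
    Reached F εg εH (x · ω) (pathHess σ (x · ω) (S · ω)) T ∧
    Stops F εg εH (x T ω) (pathHess σ (x · ω) (S · ω) T) ∧
    ‖gradient F (x T ω)‖ ≤ εg ∧ -(ε T ω + εH) ≤ lamMin (hess F (x T ω))} with hG
  -- Off the bad events, `N` computed steps would contradict `steps_le` because `N > C₀ / q`; so the
  -- run stops at some `T < N`, where the Hessian is still accurate.
  have hcover : ∀ᵐ ω ∂μ, ω ∈ G ∪ ⋃ t ∈ Finset.range N, bad t := by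
    filter_upwards [ae_all_iff.2 hgood, hrun.path, hrun.tolerance, hrun.descent, hrun.lipschitz]
      with ω h1 h2 h3 h4 h5
    by_cases hb : ω ∈ ⋃ t ∈ Finset.range N, bad t
    · exact Or.inr hb
    left
    have hb' : ∀ t < N, ω ∉ bad t := fun t ht hω => hb (by
      simp only [Set.mem_iUnion, Finset.mem_range]; exact ⟨t, ht, hω⟩)
    have hacc : ∀ t < N, Reached F εg εH (x · ω) (pathHess σ (x · ω) (S · ω)) t →
        ‖pathHess σ (x · ω) (S · ω) t - hess F (x t ω)‖ ≤ ε t ω :=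
      fun t ht => h1 t (hb' t ht)
    obtain ⟨T, hT, hTr, hTs⟩ := exists_stop (F := F) (εg := εg) (εH := εH) (x := (x · ω))
        (H := pathHess σ (x · ω) (S · ω)) (N := N) fun hact => by
      have := steps_le hF hη hγ hν hα hΔ₀ hL ⟨hg, hg1⟩ ⟨hH, hH1⟩
        (fun y => (hD y).trans (le_max_left _ 0))
        (fun t => (σ.norm_subHess_le hn hf (x t ω) (fun i => hK i _) (S t ω)).trans
          (hB.trans (le_max_left _ 0))) h2 h4 h5
        (fun t ht => (hacc t ht (hact t ht).1).trans (h3 t (hact t ht).1).2) hact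
      rw [min_sq_mul_eq hg hH] at this
      exact absurd hNlt (not_lt.2 this)
    refine ⟨T, le_trans ?_ hNle, hTr, hTs, hTs.1, ?_⟩
    · exact_mod_cast hT
    · have := lamMin_sub_le (hF.isSymm_hess (x T ω)) (σ.isSymm_subHess hf (x T ω) (S T ω)) hd
        (hacc T hT hTr)
      have h6 := hTs.2
      change -εH ≤ lamMin (subHess f (σ.prob (x T ω)) (S T ω) (x T ω)) at h6
      linarith
  have hsum : μ (⋃ t ∈ Finset.range N, bad t) ≤ ENNReal.ofReal δ := by
    calc _ ≤ ∑ t ∈ Finset.range N, μ (bad t) := measure_biUnion_finset_le _ _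
      _ ≤ ∑ _t ∈ Finset.range N, ENNReal.ofReal (δ₀ ^ (4 / 3 : ℝ)) :=
          Finset.sum_le_sum fun t _ => hbad t
      _ = ENNReal.ofReal (N * δ₀ ^ (4 / 3 : ℝ)) := by
          rw [Finset.sum_const, Finset.card_range, nsmul_eq_mul,
            ENNReal.ofReal_mul (Nat.cast_nonneg _), ENNReal.ofReal_natCast]
      _ ≤ ENNReal.ofReal δ := by
          refine ENNReal.ofReal_le_ofReal (le_trans ?_ (sum_failure_le hC hq0 hδ))
          gcongr
  rw [ENNReal.ofReal_sub _ hδ.le, ENNReal.ofReal_one, tsub_le_iff_right]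
  -- Subadditivity of `μ` is enough, so measurability of `G` is not needed.
  calc (1 : ENNReal) = μ Set.univ := measure_univ.symm
    _ ≤ μ (G ∪ ⋃ t ∈ Finset.range N, bad t) := by
        refine measure_mono_ae ?_
        filter_upwards [hcover] with ω hω _ using hω
    _ ≤ μ G + μ (⋃ t ∈ Finset.range N, bad t) := measure_union_le _ _
    _ ≤ _ := by gcongr
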